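/- Let $H$ be a separable complex Hilbert space, $D=D^*$ a selfadjoint operator on $H$ with compact resolvent, $\{h_m\}$ an orthonormal basis of $H$ consisting of eigenvectors of $D$, $Dh_m=\lambda_m h_m$, and $G:\mathbb{R}\to\mathbb{C}$ a bounded Borel function; $G(D)$ is the bounded operator with $G(D)h_m=G(\lambda_m)h_m$. Let $(F,\mu)$ be a measure space and $U:H\to L^2(F,\mu)$ a unitary (for example, a joint spectral representation of finitely many commuting bounded selfadjoint operators on $H$). For a $\mu$-measurable function $f:F\to\mathbb{C}$ let $T_f=U^*M_fU$, where $M_f$ is multiplication by $f$ with its maximal domain in $L^2(F,\mu)$, and let $T_fG(D)$ have its natural domain $\{x\in H : G(D)x\in\mathrm{dom}(T_f)\}$. Let $\mathcal{L}^{1,\infty}$ be the set of compact operators $T$ on $H$ with $\sup_{k\ge1}\log(1+k)^{-1}\sum_{n=1}^k\mu_n(T)<\infty$, where $\mu_n(T)$ are the singular values of $T$ in decreasing order. For $T\in\mathcal{L}^{1,\infty}$ put $$\|T\|_{Z_1}:=\limsup_{s\to1^+}\,(s-1)\,\mathrm{Tr}(|T|^s)^{1/s}.$$ The statement $T_fG(D)\in\mathcal{L}^{1,\infty}$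 means that $T_fG(D)$ is densely defined and that its closure is a bounded operator on $H$ belonging to $\mathcal{L}^{1,\infty}$; $\|T_fG(D)\|_{Z_1}$ refers to this closure. For $s>1$ let $\mu_s$ be the measure on $F$ with density $\sum_m|G(\lambda_m)|^s|(Uh_m)(x)|^2$ with respect to $\mu$. Put $\|f\|_{1,\infty,2}:=\sup_{1<s\le2}(s-1)^{1/2}\|f\|_{L^2(F,\mu_s)}$, and let $L^2(F,\mu_{1,\infty})$ be the set of those $f$ with $f\in L^2(F,\mu_s)$ for all $s>1$ and $\|f\|_{1,\infty,2}<\infty$. Suppose that $G(D)\in\mathcal{L}^{1,\infty}$. Then for every $\mu$-measurable $f:F\to\mathbb{C}$: (i) if $T_fG(D)\in\mathcal{L}^{1,\infty}$, then $f\in L^2(F,\mu_2)$; (ii) if $f\in L^2(F,\mu_{1,\infty})$, then $T_fG(D)\in\mathcal{L}^{1,\infty}$, and $$\|T_fG(D)\|_{Z_1}\le\|f\|_{1,\infty,2}\,\|G(D)\|_{Z_1}^{1/2}.$$ -/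

import Mathlib

open MeasureTheory Filter Topology
open scoped ENNReal InnerProductSpace

noncomputable section

namespace CwikelType

/-! ### Ideals of compact operators -/

section Ideals

variable {H : Type*} [NormedAddCommGroup H] [InnerProductSpace ℂ H]

/-- The singular values of a bounded operator, indexed from `0` (so `singularValue T n` is the
`(n+1)`-st one): the distance from `T` to the operators of rank at most `n`. For a compact
operator this is the `(n+1)`-st largest eigenvalue of `|T|`, counted with multiplicity. -/
def singularValue (T : H →L[ℂ] H) (n : ℕ) : ℝ :=
  sInf {r : ℝ | ∃ R : H →L[ℂ] H,
    LinearMap.rank (R : H →ₗ[ℂ] H) ≤ (n : Cardinal) ∧ r = ‖T - R‖}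

/-- The ideal `𝓛^{1,∞}`: compact operators with
`sup_k log(1+k)⁻¹ ∑_{n=1}^k μ_n(T) < ∞`. -/
def MemWeakTraceIdeal (T : H →L[ℂ] H) : Prop :=
  IsCompactOperator T ∧
    ∃ C : ℝ, ∀ k : ℕ, 1 ≤ k →
      (Real.log (1 + (k : ℝ)))⁻¹ * ∑ n ∈ Finset.range k, singularValue T n ≤ C

variable [CompleteSpace H]

/-- Some orthonormal basis of `H`, indexed by a set of vectors. -/
def chosenBasis (H : Type*) [NormedAddCommGroup H] [InnerProductSpace ℂ H] [CompleteSpace H] :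
    HilbertBasis (exists_hilbertBasis ℂ H).choose ℂ H :=
  (exists_hilbertBasis ℂ H).choose_spec.choose

/-- The trace `∑ ⟪b, A b⟫ ∈ [0, ∞]` of a positive bounded operator, the sum being over an
orthonormal basis of `H` (its value does not depend on the basis). -/
def positiveTrace (A : H →L[ℂ] H) : ℝ≥0∞ :=
  ∑' i, ENNReal.ofReal (RCLike.re ⟪chosenBasis H i, A (chosenBasis H i)⟫_ℂ)

/-- `‖T‖_{Z₁} = limsup_{s → 1⁺} (s - 1) Tr(|T|^s)^{1/s}`, where `|T|^s` is given by the
continuous functional calculus. -/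
def zNorm (T : H →L[ℂ] H) : ℝ≥0∞ :=
  limsup (fun s : ℝ => ENNReal.ofReal (s - 1) * positiveTrace (CFC.abs T ^ s) ^ (1 / s))
    (𝓝[>] (1 : ℝ))

end Ideals

/-! ### Unbounded operators -/

section Unbounded

variable {H : Type*} [NormedAddCommGroup H] [InnerProductSpace ℂ H]

/-- The operator `D` has compact resolvent: for some `z ∈ ℂ` the operator `D - z` is a bijection of
the domain of `D` onto `H` whose inverse is a compact operator. -/
def HasCompactResolvent (D : H →ₗ.[ℂ] H) : Prop :=
  ∃ (z : ℂ) (R : H →L[ℂ] H), IsCompactOperator R ∧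
    (∀ x : H, ∃ hx : R x ∈ D.domain, D ⟨R x, hx⟩ - z • R x = x) ∧
    ∀ x : D.domain, R (D x - z • (x : H)) = x

/-- `v` is an eigenvector of `D` in its domain for the eigenvalue `z`
(nonzero-ness is not included). -/
def IsEigenvectorOf (D : H →ₗ.[ℂ] H) (v : H) (z : ℂ) : Prop :=
  ∃ hv : v ∈ D.domain, D ⟨v, hv⟩ = z • v

/-- The product `S B` of an unbounded operator `S` and a bounded operator `B`, on its natural domain
`{x | B x ∈ dom S}`. -/
def compBounded (S : H →ₗ.[ℂ] H) (B : H →L[ℂ] H) : H →ₗ.[ℂ] H where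
  domain := S.domain.comap (B : H →ₗ[ℂ] H)
  toFun :=
    { toFun := fun x => S ⟨B x, x.2⟩
      map_add' := fun x y => by
        rw [← S.map_add]
        congr 1
        exact Subtype.ext (map_add B (x : H) (y : H))
      map_smul' := fun c x => by
        rw [RingHom.id_apply, ← S.map_smul]
        congr 1
        exact Subtype.ext (map_smul B c (x : H)) }

/-- `A` is densely defined and its closure is the everywhere defined bounded operator `T`. -/
def HasBoundedClosure (A : H →ₗ.[ℂ] H) (T : H →L[ℂ] H) : Prop :=
  Dense (A.domain : Set H) ∧ A.IsClosable ∧ A.closure = (T : H →ₗ[ℂ] H).toPMap ⊤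

/-- An unbounded operator belongs to `𝓛^{1,∞}` if it is densely defined and has a bounded closure
that belongs to `𝓛^{1,∞}`. -/
def ClosureMemWeakTraceIdeal (A : H →ₗ.[ℂ] H) : Prop :=
  ∃ T : H →L[ℂ] H, HasBoundedClosure A T ∧ MemWeakTraceIdeal T

end Unbounded

/-! ### The operator `G(D)` -/

section Diagonal

variable {H ι : Type*} [NormedAddCommGroup H] [InnerProductSpace ℂ H]

lemma memℓp_mul_of_bounded {c : ι → ℂ} (hc : ∃ C : ℝ, ∀ i, ‖c i‖ ≤ C)
    (x : lp (fun _ : ι => ℂ) 2) : Memℓp (fun i => c i * x i) 2 := by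
  obtain ⟨C, hC⟩ := hc
  refine ((lp.memℓp x).const_smul (C : ℂ)).mono' ?_
  intro i
  have h0 : 0 ≤ C := (norm_nonneg _).trans (hC i)
  simp only [Pi.smul_apply, smul_eq_mul, norm_mul, Complex.norm_real, Real.norm_eq_abs,
    abs_of_nonneg h0]
  exact mul_le_mul_of_nonneg_right (hC i) (norm_nonneg _)

/-- The bounded operator with eigenvectors `b i` and eigenvalues `c i`: in the coordinates of the
orthonormal basis `b` it is multiplication by the bounded family `c`. -/
def diagonalOperator (b : HilbertBasis ι ℂ H) (c : ι → ℂ) (hc : ∃ C : ℝ, ∀ i, ‖c i‖ ≤ C) :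
    H →L[ℂ] H :=
  LinearMap.mkContinuousOfExistsBound
    { toFun := fun x => b.repr.symm ⟨fun i => c i * b.repr x i, memℓp_mul_of_bounded hc _⟩
      map_add' := fun x y => by
        rw [← map_add b.repr.symm]
        congr 1
        ext i
        rw [map_add]
        exact mul_add _ _ _
      map_smul' := fun a x => by
        rw [RingHom.id_apply, ← map_smul b.repr.symm]
        congr 1
        ext i
        simp [mul_left_comm] }
    (by
      obtain ⟨C, hC⟩ := id hc
      refine ⟨|C|, fun x => ?_⟩
      have hn : ‖|C|‖ = |C| := by simp
      have key : ‖(⟨fun i => c i * b.repr x i, memℓp_mul_of_bounded hc _⟩ :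
          lp (fun _ : ι => ℂ) 2)‖ ≤ ‖((|C| : ℝ) : ℂ) • b.repr x‖ := by
        refine lp.norm_mono (by norm_num) fun i => ?_
        simp only [lp.coeFn_smul, Pi.smul_apply, smul_eq_mul, norm_mul, Complex.norm_real, hn]
        exact mul_le_mul_of_nonneg_right ((hC i).trans (le_abs_self C)) (norm_nonneg _)
      rw [lp.norm_const_smul (by norm_num), Complex.norm_real, hn,
        LinearIsometryEquiv.norm_map] at key
      simpa using key)

lemma diagonalOperator_apply_basis (b : HilbertBasis ι ℂ H) (c : ι → ℂ)
    (hc : ∃ C : ℝ, ∀ i, ‖c i‖ ≤ C) (i : ι) : diagonalOperator b c hc (b i) = c i • b i := by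
  classical
  apply b.repr.injective
  rw [map_smul]
  change b.repr (b.repr.symm _) = _
  rw [LinearIsometryEquiv.apply_symm_apply]
  ext j
  change c j * b.repr (b i) j = c i * b.repr (b i) j
  rw [b.repr_self i]
  by_cases hij : j = i
  · subst hij
    rfl
  · simp [hij]

/-- `G(D)`, for an orthonormal basis `h` of eigenvectors of `D` with eigenvalues `ev`:
`G(D) h_m = G(λ_m) h_m`. -/
def functionOf (G : ℝ → ℂ) (hG : ∃ C : ℝ, ∀ x, ‖G x‖ ≤ C) (h : HilbertBasis ι ℂ H)
    (ev : ι → ℝ) : H →L[ℂ] H :=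
  diagonalOperator h (fun m => G (ev m)) (hG.imp fun _ hC m => hC (ev m))

end Diagonal

/-! ### Multiplication operators and weighted `L^p` spaces -/

section Multiplication

variable {H F ι : Type*} [NormedAddCommGroup H] [InnerProductSpace ℂ H]
  [MeasurableSpace F] {μ : Measure F}

/-- The maximal domain `{x | f · U x ∈ L²(F, μ)}` of `U⁻¹ M_f U`. -/
def multiplicationDomain (U : H ≃ₗᵢ[ℂ] Lp ℂ 2 μ) (f : F → ℂ) : Submodule ℂ H where
  carrier := {x | MemLp (fun t => f t * U x t) 2 μ}
  add_mem' := fun {x y} hx hy => by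
    refine (memLp_congr_ae ?_).mp (MemLp.add hx hy)
    rw [map_add]
    filter_upwards [Lp.coeFn_add (U x) (U y)] with t ht
    rw [ht]
    simp only [Pi.add_apply, mul_add]
  zero_mem' := by
    refine (memLp_congr_ae ?_).mp (MemLp.zero (μ := μ) (ε := ℂ) (p := 2))
    rw [map_zero]
    filter_upwards [Lp.coeFn_zero ℂ 2 μ] with t ht
    rw [ht]
    simp only [Pi.zero_apply, mul_zero]
  smul_mem' := fun a x hx => by
    refine (memLp_congr_ae ?_).mp (MemLp.const_smul hx a)
    rw [map_smul]
    filter_upwards [Lp.coeFn_smul a (U x)] with t ht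
    rw [ht]
    simp only [Pi.smul_apply, smul_eq_mul, mul_left_comm]

lemma mem_multiplicationDomain_iff {U : H ≃ₗᵢ[ℂ] Lp ℂ 2 μ} {f : F → ℂ} {x : H} :
    x ∈ multiplicationDomain U f ↔ MemLp (fun t => f t * U x t) 2 μ := Iff.rfl

/-- `T_f = U⁻¹ M_f U`, where `M_f` is multiplication by the (possibly unbounded) function `f` on
`L²(F, μ)` with its maximal domain. -/
def multiplicationOperator (U : H ≃ₗᵢ[ℂ] Lp ℂ 2 μ) (f : F → ℂ) : H →ₗ.[ℂ] H where
  domain := multiplicationDomain U f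
  toFun :=
    { toFun := fun x => U.symm (MemLp.toLp (fun t => f t * U (x : H) t)
        (mem_multiplicationDomain_iff.mp x.2))
      map_add' := fun x y => by
        rw [← map_add U.symm]
        congr 1
        have hx := mem_multiplicationDomain_iff.mp x.2
        have hy := mem_multiplicationDomain_iff.mp y.2
        refine (MemLp.toLp_congr _ (hx.add hy) ?_).trans (MemLp.toLp_add hx hy)
        rw [Submodule.coe_add, map_add]
        filter_upwards [Lp.coeFn_add (U (x : H)) (U (y : H))] with t ht
        rw [ht]
        simp only [Pi.add_apply, mul_add]
      map_smul' := fun a x => by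
        rw [RingHom.id_apply, ← map_smul U.symm]
        congr 1
        have hx := mem_multiplicationDomain_iff.mp x.2
        refine (MemLp.toLp_congr _ (hx.const_smul a) ?_).trans (MemLp.toLp_const_smul a hx)
        rw [Submodule.coe_smul, map_smul]
        filter_upwards [Lp.coeFn_smul a (U (x : H))] with t ht
        rw [ht]
        simp only [Pi.smul_apply, smul_eq_mul, mul_left_comm] }

/-- The measure `μ_s`, with density `∑_m |G(λ_m)|^s |(U h_m)(x)|²` with respect to `μ`. -/
def spectralMeasure (U : H ≃ₗᵢ[ℂ] Lp ℂ 2 μ) (h : HilbertBasis ι ℂ H) (ev : ι → ℝ) (G : ℝ → ℂ)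
    (s : ℝ) : Measure F :=
  μ.withDensity fun x => ∑' m, ENNReal.ofReal (‖G (ev m)‖ ^ s * ‖U (h m) x‖ ^ 2)

/-- `‖f‖_{1,∞,p} = sup_{1 < s ≤ 2} (s - 1)^{1/p} ‖f‖_{L^p(μ_s)}`. -/
def weakNorm (U : H ≃ₗᵢ[ℂ] Lp ℂ 2 μ) (h : HilbertBasis ι ℂ H) (ev : ι → ℝ) (G : ℝ → ℂ)
    (p : ℝ≥0∞) (f : F → ℂ) : ℝ≥0∞ :=
  ⨆ s ∈ Set.Ioc (1 : ℝ) 2,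
    ENNReal.ofReal (s - 1) ^ (1 / p.toReal) * eLpNorm f p (spectralMeasure U h ev G s)

/-- `f ∈ L^p(F, μ_{1,∞})`: `f ∈ L^p(F, μ_s)` for all `s > 1`, and `‖f‖_{1,∞,p} < ∞`. -/
def MemWeakLp (U : H ≃ₗᵢ[ℂ] Lp ℂ 2 μ) (h : HilbertBasis ι ℂ H) (ev : ι → ℝ) (G : ℝ → ℂ)
    (p : ℝ≥0∞) (f : F → ℂ) : Prop :=
  (∀ s : ℝ, 1 < s → MemLp f p (spectralMeasure U h ev G s)) ∧ weakNorm U h ev G p f < ∞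

end Multiplication

end CwikelType

end

/-! Write `g m = |G(λ_m)|` and let `α m` be the integral of `|f|² |U h_m|²`. Two identities drive
the argument: `‖f‖²` in `L²(μ_s)` equals `∑ g^s α`, and an operator `T` closing `T_f G(D)` satisfies
`‖T h_m‖² = g m ^ 2 * α m`. At `s = 2` the first sum is therefore the squared Hilbert–Schmidt norm
of `T`. This gives (i), since operators in `𝓛^{1,∞}` are Hilbert–Schmidt, and in (ii) it produces a
compact `T` with the prescribed columns; `T_f G(D)` is closed, so agreement on the basis suffices.

For `1 < s ≤ 2`, McCarthy's inequality (`IsSingularBasis.tsum_rpow_le`) bounds `Tr |T|^s` by `∑ ‖T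
h_m‖^s`, and Hölder with exponents `2/s` and `2/(2-s)` then gives `‖T‖_s ≤ ‖f‖_{L²(μ_s)} Γ^(1/s -
1/2)` with `Γ = ∑ g^s = Tr |G(D)|^s`. Multiplying by `s - 1`, half of this factor goes to `f` and
half to `Γ^(1/(2s))`; the leftover power `Γ^(-(s-1)/(2s))` is bounded by a quantity tending to `1`.
This is the norm estimate.

Membership of `T` rests on the link between `𝓛^{1,∞}` and growth of Schatten norms. Majorization by
`C/(n+1)` turns the logarithmic bound for `G(D)` into `Γ = O(1/(s-1))`, hence `‖T‖_s = O(1/(s-1))`;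
Hölder on the first `k` singular values at `s = 1 + 1/log(1+k)` turns this back into a logarithmic
bound. -/

namespace CwikelType

universe u

/-! ### Majorization and elementary real inequalities -/

section RealInequalities

/-- Abel summation: lowering the weight on a nonnegative partial sum only decreases it, so induction
carries the stronger bound with `c j` times the whole partial sum. -/
theorem sum_mul_nonneg_of_antitone {d c : ℕ → ℝ} (hc : Antitone c) (hc0 : ∀ n, 0 ≤ c n) (k : ℕ)
    (hd : ∀ j ≤ k, 0 ≤ ∑ n ∈ Finset.range j, d n) : 0 ≤ ∑ n ∈ Finset.range k, d n * c n := by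
  suffices H : ∀ j ≤ k, c j * ∑ n ∈ Finset.range j, d n ≤ ∑ n ∈ Finset.range j, d n * c n from
    (mul_nonneg (hc0 k) (hd k le_rfl)).trans (H k le_rfl)
  intro j
  induction j with
  | zero => simp
  | succ j ih =>
    intro hj
    rw [Finset.sum_range_succ (fun n => d n * c n)]
    have h1 := ih (by omega)
    have h2 : c (j + 1) * ∑ n ∈ Finset.range (j + 1), d n ≤
        c j * ∑ n ∈ Finset.range (j + 1), d n :=
      mul_le_mul_of_nonneg_right (hc (Nat.le_succ j)) (hd _ hj)
    rw [Finset.sum_range_succ d] at h2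
    rw [Finset.sum_range_succ d]
    linarith [mul_add (c j) (∑ n ∈ Finset.range j, d n) (d j), mul_comm (d j) (c j)]

/-- The Hardy–Littlewood–Pólya majorization inequality for the power function. -/
theorem sum_rpow_le_of_majorized {a b : ℕ → ℝ} (ha : Antitone a) (ha0 : ∀ n, 0 ≤ a n)
    (hb0 : ∀ n, 0 ≤ b n) (k : ℕ)
    (hab : ∀ j ≤ k, ∑ n ∈ Finset.range j, a n ≤ ∑ n ∈ Finset.range j, b n) {s : ℝ} (hs : 1 < s) :
    ∑ n ∈ Finset.range k, a n ^ s ≤ ∑ n ∈ Finset.range k, b n ^ s := by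
  -- Since `s > 1`, the weights `a^(s-1)` inherit monotonicity from `a`. Young's inequality on `b *
  -- a^(s-1)` then lets the `a^s` part be absorbed.
  have h1 : 0 ≤ ∑ n ∈ Finset.range k, (b n - a n) * a n ^ (s - 1) := by
    refine sum_mul_nonneg_of_antitone (fun i j hij => ?_) (fun n => ?_) k fun j hj => ?_
    · exact Real.rpow_le_rpow (ha0 _) (ha hij) (by linarith)
    · exact Real.rpow_nonneg (ha0 n) _
    · rw [Finset.sum_sub_distrib]
      exact sub_nonneg.2 (hab j hj)
  have hpow : ∀ n, a n * a n ^ (s - 1) = a n ^ s := fun n => by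
    rw [← Real.rpow_one_add' (ha0 n) (by linarith)]
    congr 1
    ring
  have hs0 : 0 < s := by linarith
  have hpq : s.HolderConjugate (s / (s - 1)) := Real.HolderConjugate.conjExponent hs
  have h2 : ∀ n, b n * a n ^ (s - 1) ≤ b n ^ s / s + (1 - 1 / s) * a n ^ s := fun n => by
    have := Real.young_inequality_of_nonneg (hb0 n) (Real.rpow_nonneg (ha0 n) (s - 1)) hpq
    rw [← Real.rpow_mul (ha0 n)] at this
    have e1 : (s - 1) * (s / (s - 1)) = s := by
      have : s - 1 ≠ 0 := by linarith
      field_simp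
    rw [e1] at this
    refine this.trans (le_of_eq ?_)
    have : s - 1 ≠ 0 := by linarith
    field_simp
  have h3 : ∑ n ∈ Finset.range k, b n * a n ^ (s - 1) ≤
      (∑ n ∈ Finset.range k, b n ^ s) / s + (1 - 1 / s) * ∑ n ∈ Finset.range k, a n ^ s := by
    rw [Finset.sum_div, Finset.mul_sum, ← Finset.sum_add_distrib]
    exact Finset.sum_le_sum fun n _ => h2 n
  have h4 : ∑ n ∈ Finset.range k, (b n - a n) * a n ^ (s - 1) =
      ∑ n ∈ Finset.range k, b n * a n ^ (s - 1) - ∑ n ∈ Finset.range k, a n ^ s := by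
    rw [← Finset.sum_sub_distrib]
    exact Finset.sum_congr rfl fun n _ => by rw [sub_mul, hpow]
  rw [h4] at h1
  have h5 : (∑ n ∈ Finset.range k, a n ^ s) / s ≤ (∑ n ∈ Finset.range k, b n ^ s) / s := by
    have : (1 - 1 / s) * ∑ n ∈ Finset.range k, a n ^ s =
      ∑ n ∈ Finset.range k, a n ^ s - (∑ n ∈ Finset.range k, a n ^ s) / s := by ring
    linarith
  exact (div_le_div_iff_of_pos_right hs0).1 h5

/-- Integral comparison: the first term is `1` and the others are bounded by the integral of
`x^(-s)` over `[1, ∞)`, which is `1/(s-1)`. -/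
theorem sum_inv_rpow_le {s : ℝ} (hs : 1 < s) (k : ℕ) :
    ∑ n ∈ Finset.range k, (((n : ℝ) + 1)⁻¹) ^ s ≤ s / (s - 1) := by
  have hs1 : 0 < s - 1 := by linarith
  rcases k with _ | k
  · simp only [Finset.range_zero, Finset.sum_empty]
    positivity
  rw [Finset.sum_range_succ']
  have hanti : AntitoneOn (fun x : ℝ => x ^ (-s)) (Set.Icc (1 : ℝ) (1 + (k : ℕ))) := by
    intro x hx y hy hxy
    exact Real.rpow_le_rpow_of_nonpos (by linarith [hx.1]) hxy (by linarith)
  have h1 := hanti.sum_le_integral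
  have h2 : ∫ x in (1 : ℝ)..(1 + (k : ℕ)), x ^ (-s) =
      ((1 + (k : ℝ)) ^ (-s + 1) - 1 ^ (-s + 1)) / (-s + 1) := by
    refine integral_rpow (Or.inr ⟨by linarith, ?_⟩)
    rw [Set.uIcc_of_le (by linarith [(Nat.cast_nonneg k : (0 : ℝ) ≤ k)])]
    simp
  rw [h2] at h1
  have h3 : ((1 + (k : ℝ)) ^ (-s + 1) - 1 ^ (-s + 1)) / (-s + 1) ≤ 1 / (s - 1) := by
    rw [Real.one_rpow, show -s + 1 = -(s - 1) by ring, div_neg, ← neg_div]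
    refine div_le_div_of_nonneg_right ?_ hs1.le
    have : 0 ≤ (1 + (k : ℝ)) ^ (-(s - 1)) := by positivity
    linarith
  have h4 : ∑ n ∈ Finset.range k, ((((n + 1 : ℕ) : ℝ) + 1)⁻¹) ^ s =
      ∑ i ∈ Finset.range k, (1 + ((i + 1 : ℕ) : ℝ)) ^ (-s) := by
    refine Finset.sum_congr rfl fun n _ => ?_
    rw [Real.inv_rpow (by positivity), Real.rpow_neg (by positivity), add_comm]
  rw [h4]
  have h5 : s / (s - 1) = 1 / (s - 1) + 1 := by
    field_simp
    ring
  rw [h5]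
  simp only [Nat.cast_zero, zero_add, inv_one, Real.one_rpow]
  linarith

theorem log_one_add_le_sum_inv (k : ℕ) :
    Real.log (1 + (k : ℝ)) ≤ ∑ n ∈ Finset.range k, ((n : ℝ) + 1)⁻¹ := by
  have := log_add_one_le_harmonic k
  rw [harmonic] at this
  push_cast at this
  simpa [add_comm] using this

theorem exists_antitone_enumeration {J : Type*} (S : Finset J) (t : J → ℝ) :
    ∃ v : Fin S.card → J, Function.Injective v ∧ Antitone (t ∘ v) ∧
      ∀ φ : J → ℝ, ∑ i, φ (v i) = ∑ j ∈ S, φ j := by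
  let e := S.equivFin.symm
  let f : Fin S.card → ℝ := fun i => -t (e i)
  refine ⟨fun i => e (Tuple.sort f i), ?_, ?_, fun φ => ?_⟩
  · exact Subtype.val_injective.comp (e.injective.comp (Tuple.sort f).injective)
  · intro i j hij
    have := Tuple.monotone_sort f hij
    simpa [f] using this
  · rw [← Finset.sum_coe_sort S φ]
    exact ((Tuple.sort f).trans e).sum_comp (fun j : S => φ j)

end RealInequalities

/-! ### Singular values through an eigenbasis of `T⋆ T` -/

section SingularValues

variable {H : Type*} [NormedAddCommGroup H] [InnerProductSpace ℂ H]

theorem singularValue_nonneg (T : H →L[ℂ] H) (n : ℕ) : 0 ≤ singularValue T n := by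
  refine Real.sInf_nonneg ?_
  rintro r ⟨R, -, rfl⟩
  exact norm_nonneg _

theorem singularValue_le_norm_sub (T R : H →L[ℂ] H) (n : ℕ)
    (hR : LinearMap.rank (R : H →ₗ[ℂ] H) ≤ (n : Cardinal)) : singularValue T n ≤ ‖T - R‖ :=
  csInf_le ⟨0, by rintro r ⟨R, -, rfl⟩; exact norm_nonneg _⟩ ⟨R, hR, rfl⟩

theorem le_singularValue {T : H →L[ℂ] H} {n : ℕ} {r : ℝ}
    (hr : ∀ R : H →L[ℂ] H, LinearMap.rank (R : H →ₗ[ℂ] H) ≤ (n : Cardinal) → r ≤ ‖T - R‖) :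
    r ≤ singularValue T n := by
  refine le_csInf ⟨‖T - 0‖, 0, ?_, rfl⟩ ?_
  · simp
  · rintro _ ⟨R, hR, rfl⟩
    exact hr R hR

theorem hasSum_norm_inner_sq {J : Type*} (b : HilbertBasis J ℂ H) (x : H) :
    HasSum (fun j => ‖⟪b j, x⟫_ℂ‖ ^ 2) (‖x‖ ^ 2) := by
  have h := b.hasSum_inner_mul_inner x x
  have h2 := h.mapL Complex.reCLM
  convert h2 using 1
  · ext j
    rw [← inner_conj_symm x (b j), ← Complex.normSq_eq_conj_mul_self]
    simp [Complex.normSq_eq_norm_sq, -Complex.ofReal_pow]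
  · simp [inner_self_eq_norm_sq_to_K, ← Complex.ofReal_pow]

variable [CompleteSpace H] {J : Type*}

/-- `b` is an orthonormal basis of eigenvectors of `T⋆ T`, with eigenvalues `t j ^ 2`. -/
structure IsSingularBasis (T : H →L[ℂ] H) (b : HilbertBasis J ℂ H) (t : J → ℝ) : Prop where
  nonneg : ∀ j, 0 ≤ t j
  apply_eq : ∀ j, (star T * T) (b j) = ((t j ^ 2 : ℝ) : ℂ) • b j

namespace IsSingularBasis

variable {T : H →L[ℂ] H} {b : HilbertBasis J ℂ H} {t : J → ℝ}

theorem inner_apply_apply (hb : IsSingularBasis T b t) (j : J) (x : H) :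
    ⟪T (b j), T x⟫_ℂ = (t j ^ 2 : ℝ) * ⟪b j, x⟫_ℂ := by
  have h1 : ⟪(star T * T) (b j), x⟫_ℂ = ⟪T (b j), T x⟫_ℂ := by
    rw [ContinuousLinearMap.star_eq_adjoint, mul_apply_eq_comp,
      ContinuousLinearMap.adjoint_inner_left]
  rw [← h1, hb.apply_eq, inner_smul_left, Complex.conj_ofReal]

theorem hasSum_norm_apply_sq (hb : IsSingularBasis T b t) (x : H) :
    HasSum (fun j => t j ^ 2 * ‖⟪b j, x⟫_ℂ‖ ^ 2) (‖T x‖ ^ 2) := by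
  have h := b.hasSum_inner_mul_inner x ((star T * T) x)
  have h2 := h.mapL Complex.reCLM
  have e : ∀ j, ⟪b j, (star T * T) x⟫_ℂ = (t j ^ 2 : ℝ) * ⟪b j, x⟫_ℂ := fun j => by
    rw [← hb.inner_apply_apply, ContinuousLinearMap.star_eq_adjoint,
      mul_apply_eq_comp, ContinuousLinearMap.adjoint_inner_right]
  convert h2 using 1
  · ext j
    rw [e, ← inner_conj_symm x (b j), mul_left_comm, ← Complex.normSq_eq_conj_mul_self]
    simp [Complex.normSq_eq_norm_sq, -Complex.ofReal_pow, ← Complex.ofReal_mul]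
  · rw [ContinuousLinearMap.star_eq_adjoint, mul_apply_eq_comp,
      ContinuousLinearMap.adjoint_inner_right]
    simp [inner_self_eq_norm_sq_to_K, ← Complex.ofReal_pow]

theorem norm_apply (hb : IsSingularBasis T b t) (j : J) : ‖T (b j)‖ = t j := by
  have h := hb.inner_apply_apply j (b j)
  rw [inner_self_eq_norm_sq_to_K, inner_self_eq_norm_sq_to_K, b.orthonormal.1 j] at h
  have : ‖T (b j)‖ ^ 2 = t j ^ 2 := by
    have h' := congrArg Complex.re h
    simpa [← Complex.ofReal_pow] using h'
  exact (pow_left_inj₀ (norm_nonneg _) (hb.nonneg j) two_ne_zero).1 this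

/-- The min-max argument: an operator of rank at most `n` kills a nonzero vector in the span of `n +
1` basis vectors, and `T` stretches that vector by at least `r`. -/
theorem le_singularValue (hb : IsSingularBasis T b t) {n : ℕ} {r : ℝ} {u : Fin (n + 1) → J}
    (hu : Function.Injective u) (hr : ∀ i, r ≤ t (u i)) : r ≤ singularValue T n := by
  classical
  refine CwikelType.le_singularValue fun R hR => ?_
  rcases lt_or_ge r 0 with hr0 | hr0
  · exact hr0.le.trans (norm_nonneg _)
  have hou : Orthonormal ℂ (b ∘ u) := b.orthonormal.comp u hu
  let φ : (Fin (n + 1) → ℂ) →ₗ[ℂ] H := Fintype.linearCombination ℂ (b ∘ u)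
  let ψ : (Fin (n + 1) → ℂ) →ₗ[ℂ] LinearMap.range (R : H →ₗ[ℂ] H) :=
    (R : H →ₗ[ℂ] H).rangeRestrict ∘ₗ φ
  have hfin : Module.Finite ℂ (LinearMap.range (R : H →ₗ[ℂ] H)) :=
    Module.rank_lt_aleph0_iff.1 (hR.trans_lt (Cardinal.natCast_lt_aleph0))
  have hlt : Module.finrank ℂ (LinearMap.range (R : H →ₗ[ℂ] H)) <
      Module.finrank ℂ (Fin (n + 1) → ℂ) := by
    rw [Module.finrank_fin_fun, Nat.lt_succ_iff]
    exact Module.finrank_le_of_rank_le hR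
  obtain ⟨c, hc, hc0⟩ := (Submodule.ne_bot_iff _).1 (LinearMap.ker_ne_bot_of_finrank_lt hlt (f := ψ))
  have hRc : R (φ c) = 0 := congrArg Subtype.val (LinearMap.mem_ker.1 hc)
  have hin : ∀ j, ⟪b j, φ c⟫_ℂ = ∑ i, if u i = j then c i else 0 := fun j => by
    simp only [φ, Fintype.linearCombination_apply, inner_sum, inner_smul_right, Function.comp]
    refine Finset.sum_congr rfl fun i _ => ?_
    rw [orthonormal_iff_ite.1 b.orthonormal]
    simp [eq_comm]
  have hzero : ∀ j, j ∉ Set.range u → ⟪b j, φ c⟫_ℂ = 0 := fun j hj => by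
    rw [hin]
    exact Finset.sum_eq_zero fun i _ => if_neg fun h => hj ⟨i, h⟩
  have hφ : φ c ≠ 0 := fun h0 => hc0 <| by
    have := Fintype.linearIndependent_iff.1 hou.linearIndependent c (by
      simpa [φ, Fintype.linearCombination_apply] using h0)
    exact funext this
  have hge : r * ‖φ c‖ ≤ ‖T (φ c)‖ := by
    refine le_of_sq_le_sq ?_ (norm_nonneg _)
    rw [mul_pow]
    refine hasSum_le (fun j => ?_) ((hasSum_norm_inner_sq b (φ c)).mul_left (r ^ 2))
      (hb.hasSum_norm_apply_sq (φ c))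
    by_cases hj : j ∈ Set.range u
    · obtain ⟨i, rfl⟩ := hj
      have := hr i
      gcongr
    · simp [hzero j hj]
  have hle : ‖T (φ c)‖ ≤ ‖T - R‖ * ‖φ c‖ := by
    have := (T - R).le_opNorm (φ c)
    rwa [sub_apply, hRc, sub_zero] at this
  exact le_of_mul_le_mul_right (hge.trans hle) (norm_pos_iff.2 hφ)

/-- The competitor is `T P` with `P` the projection onto the span of `S`; what remains of `T` only
sees the `t j` with `j ∉ S`. -/
theorem singularValue_le (hb : IsSingularBasis T b t) {n : ℕ} {r : ℝ} (hr0 : 0 ≤ r)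
    {S : Finset J} (hS : S.card ≤ n) (hr : ∀ j ∉ S, t j ≤ r) : singularValue T n ≤ r := by
  classical
  let P : H →L[ℂ] H := ∑ j ∈ S, (innerSL ℂ (b j)).smulRight (b j)
  have hP : ∀ x, P x = ∑ j ∈ S, ⟪b j, x⟫_ℂ • b j := fun x => by
    simp [P]
  have hrank : LinearMap.rank ((T ∘L P : H →L[ℂ] H) : H →ₗ[ℂ] H) ≤ (n : Cardinal) := by
    have hsub : LinearMap.range ((T ∘L P : H →L[ℂ] H) : H →ₗ[ℂ] H) ≤
        Submodule.span ℂ (S.image fun j => T (b j) : Set H) := by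
      rintro _ ⟨x, rfl⟩
      change T (P x) ∈ _
      rw [hP, map_sum]
      refine Submodule.sum_mem _ fun j hj => ?_
      rw [map_smul]
      exact Submodule.smul_mem _ _ (Submodule.subset_span (by
        simpa using ⟨j, hj, rfl⟩))
    refine (Submodule.rank_mono hsub).trans ((rank_span_finset_le _).trans ?_)
    exact_mod_cast Finset.card_image_le.trans hS
  refine (singularValue_le_norm_sub T (T ∘L P) n hrank).trans ?_
  refine ContinuousLinearMap.opNorm_le_bound _ hr0 fun x => ?_
  have hTx : (T - T ∘L P) x = T (x - P x) := by simp
  have hin : ∀ j, ⟪b j, x - P x⟫_ℂ = if j ∈ S then 0 else ⟪b j, x⟫_ℂ := fun j => by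
    rw [inner_sub_right, hP, inner_sum]
    have : ∀ i, ⟪b j, ⟪b i, x⟫_ℂ • b i⟫_ℂ = if j = i then ⟪b i, x⟫_ℂ else 0 := fun i => by
      rw [inner_smul_right, orthonormal_iff_ite.1 b.orthonormal]
      simp
    simp only [this, Finset.sum_ite_eq]
    split_ifs <;> simp
  rw [hTx]
  refine le_of_sq_le_sq ?_ (mul_nonneg hr0 (norm_nonneg _))
  rw [mul_pow]
  refine hasSum_le (fun j => ?_) (hb.hasSum_norm_apply_sq (x - P x))
    ((hasSum_norm_inner_sq b x).mul_left (r ^ 2))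
  rw [hin]
  split_ifs with hj
  · simp only [norm_zero, ne_eq, OfNat.ofNat_ne_zero, not_false_eq_true, zero_pow, mul_zero]
    positivity
  · have := hr j hj
    have := hb.nonneg j
    gcongr

theorem sum_rpow_le_of_log_bound (hb : IsSingularBasis T b t) {C : ℝ} (hC0 : 0 ≤ C)
    (hC : ∀ k : ℕ, ∑ n ∈ Finset.range k, singularValue T n ≤ C * Real.log (1 + (k : ℝ)))
    {s : ℝ} (hs : 1 < s) (S : Finset J) : ∑ j ∈ S, t j ^ s ≤ C ^ s * (s / (s - 1)) := by
  obtain ⟨v, hv, hanti, hsum⟩ := exists_antitone_enumeration S t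
  -- The decreasing rearrangement of `t` on `S`, padded by zeros, lies termwise below the singular
  -- values.
  let a : ℕ → ℝ := fun n => if hn : n < S.card then t (v ⟨n, hn⟩) else 0
  have ha0 : ∀ n, 0 ≤ a n := fun n => by
    simp only [a]
    split_ifs
    · exact hb.nonneg _
    · exact le_rfl
  have ha : Antitone a := fun i j hij => by
    by_cases hj : j < S.card
    · have hi : i < S.card := hij.trans_lt hj
      simp only [a, hi, hj, dif_pos]
      exact hanti (show (⟨i, hi⟩ : Fin S.card) ≤ ⟨j, hj⟩ from hij)
    · have : a j = 0 := by simp [a, hj]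
      rw [this]
      exact ha0 i
  have hle : ∀ n, a n ≤ singularValue T n := fun n => by
    by_cases hn : n < S.card
    · simp only [a, hn, dif_pos]
      refine hb.le_singularValue (u := fun i : Fin (n + 1) => v (Fin.castLE hn i))
        (hv.comp (Fin.castLE_injective _)) fun i => ?_
      exact hanti (show Fin.castLE hn i ≤ ⟨n, hn⟩ from Nat.lt_succ_iff.1 i.2)
    · have : a n = 0 := by simp [a, hn]
      rw [this]
      exact singularValue_nonneg T n
  have h1 : ∑ j ∈ S, t j ^ s = ∑ n ∈ Finset.range S.card, a n ^ s := by
    rw [← hsum (fun j => t j ^ s), ← Fin.sum_univ_eq_sum_range (fun n => a n ^ s)]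
    simp [a]
  rw [h1]
  -- The sequence `C/(n+1)` majorizes `a`, because harmonic sums dominate the logarithm.
  refine (sum_rpow_le_of_majorized (b := fun n => C * ((n : ℝ) + 1)⁻¹) ha ha0
    (fun n => by positivity) S.card (fun j _ => ?_) hs).trans ?_
  · rw [← Finset.mul_sum]
    exact ((Finset.sum_le_sum fun n _ => hle n).trans (hC j)).trans
      (mul_le_mul_of_nonneg_left (log_one_add_le_sum_inv j) hC0)
  · have : ∀ n : ℕ, (C * ((n : ℝ) + 1)⁻¹) ^ s = C ^ s * (((n : ℝ) + 1)⁻¹) ^ s := fun n =>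
      Real.mul_rpow hC0 (by positivity)
    simp only [this]
    rw [← Finset.mul_sum]
    exact mul_le_mul_of_nonneg_left (sum_inv_rpow_le hs _) (Real.rpow_nonneg hC0 _)

/-- Hölder on at most `k` of the numbers `t j`, whose sum nearly reaches that of the first `k`
singular values. The loss `ε` avoids having to enumerate the whole family `t` in decreasing order.
-/
theorem sum_singularValue_le (hb : IsSingularBasis T b t) {s Q : ℝ} (hs : 1 < s)
    (hQ : ∀ S : Finset J, ∑ j ∈ S, t j ^ s ≤ Q ^ s) (hQ0 : 0 ≤ Q) (k : ℕ) :
    ∑ n ∈ Finset.range k, singularValue T n ≤ (k : ℝ) ^ (1 - 1 / s) * Q := by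
  classical
  have key : ∀ ε : ℝ, 0 < ε → ∑ n ∈ Finset.range k, singularValue T n ≤
      (k : ℝ) ^ (1 - 1 / s) * Q + k * ε := by
    intro ε hε
    -- Greedy selection: if every `t j` outside `S` were at most `singularValue T m - ε > 0`, then
    -- `singularValue_le` would give a contradiction. A nonpositive term needs no new index.
    have hex : ∀ m : ℕ, ∃ S : Finset J, S.card ≤ m ∧
        ∑ n ∈ Finset.range m, (singularValue T n - ε) ≤ ∑ j ∈ S, t j := by
      intro m
      induction m with
      | zero => exact ⟨∅, by simp, by simp⟩
      | succ m ih =>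
        obtain ⟨S, hS, hle⟩ := ih
        rcases le_or_gt (singularValue T m - ε) 0 with h0 | h0
        · refine ⟨S, by omega, ?_⟩
          rw [Finset.sum_range_succ]
          linarith
        · obtain ⟨j, hj, hlt⟩ : ∃ j ∉ S, singularValue T m - ε < t j := by
            by_contra! hcon
            have := hb.singularValue_le h0.le hS hcon
            linarith
          refine ⟨insert j S, (Finset.card_insert_le _ _).trans (by omega), ?_⟩
          rw [Finset.sum_range_succ, Finset.sum_insert hj]
          linarith
    obtain ⟨S, hS, hle⟩ := hex k
    rw [Finset.sum_sub_distrib] at hle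
    simp only [Finset.sum_const, Finset.card_range, nsmul_eq_mul] at hle
    have hs0 : 0 < s := by linarith
    have hpq : s.HolderConjugate (s / (s - 1)) := Real.HolderConjugate.conjExponent hs
    have hH := Real.inner_le_Lp_mul_Lq_of_nonneg S hpq.symm (f := fun _ => (1 : ℝ)) (g := t)
      (fun _ _ => zero_le_one) (fun j _ => hb.nonneg j)
    simp only [one_mul, Real.one_rpow, Finset.sum_const, nsmul_eq_mul, mul_one] at hH
    have e1 : 1 / (s / (s - 1)) = 1 - 1 / s := by
      have : s - 1 ≠ 0 := by linarith
      field_simp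
    rw [e1] at hH
    have h0 : 0 ≤ 1 - 1 / s := by
      rw [sub_nonneg, div_le_one hs0]
      exact hs.le
    have hA : (S.card : ℝ) ^ (1 - 1 / s) ≤ (k : ℝ) ^ (1 - 1 / s) :=
      Real.rpow_le_rpow (by positivity) (by exact_mod_cast hS) h0
    have hB : (∑ j ∈ S, t j ^ s) ^ (1 / s) ≤ Q := by
      have h := Real.rpow_le_rpow (Finset.sum_nonneg fun j _ => Real.rpow_nonneg (hb.nonneg j) s)
        (hQ S) (by positivity : 0 ≤ 1 / s)
      rwa [← Real.rpow_mul hQ0, mul_one_div_cancel hs0.ne', Real.rpow_one] at h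
    have hAB := mul_le_mul hA hB (Real.rpow_nonneg (Finset.sum_nonneg fun j _ =>
      Real.rpow_nonneg (hb.nonneg j) s) _) (Real.rpow_nonneg (Nat.cast_nonneg k) _)
    linarith
  rcases Nat.eq_zero_or_pos k with rfl | hk
  · simp only [Finset.range_zero, Finset.sum_empty]
    positivity
  refine le_of_forall_pos_le_add fun ε hε => ?_
  have hk' : (0 : ℝ) < k := by exact_mod_cast hk
  have := key (ε / k) (by positivity)
  rwa [mul_div_cancel₀ _ hk'.ne'] at this

end IsSingularBasis

/-- The spectral theorem for `T⋆ T`, for a compact operator `T`. -/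
theorem exists_isSingularBasis {H : Type u} [NormedAddCommGroup H] [InnerProductSpace ℂ H]
    [CompleteSpace H] {T : H →L[ℂ] H} (hT : IsCompactOperator T) :
    ∃ (J : Type u) (b : HilbertBasis J ℂ H) (t : J → ℝ), IsSingularBasis T b t := by
  let A : H →L[ℂ] H := star T * T
  have hA : IsCompactOperator A := hT.clm_comp (star T)
  have hAs : (A : H →ₗ[ℂ] H).IsSymmetric :=
    (ContinuousLinearMap.isSelfAdjoint_iff_isSymmetric).1 (IsSelfAdjoint.star_mul_self T)
  have hbot := ContinuousLinearMap.orthogonalComplement_iSup_eigenspaces_eq_bot hA hAs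
  let E : ℂ → Submodule ℂ H := fun z => Module.End.eigenspace (A : H →ₗ[ℂ] H) z
  have hcl : ∀ z, IsClosed (E z : Set H) := fun z => by
    have : (E z : Set H) = {x | A x = z • x} := by
      ext x
      exact Module.End.mem_eigenspace_iff
    rw [this]
    exact isClosed_eq A.continuous (continuous_const_smul z)
  have hcomp : ∀ z, CompleteSpace (E z) := fun z => (hcl z).completeSpace_coe
  choose w c hc using fun z : ℂ => exists_hilbertBasis ℂ (E z)
  -- Bases of all the eigenspaces together; those for non-eigenvalues are empty.
  let v : (Σ z, w z) → H := fun j => (c j.1 j.2 : H)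
  have hv : Orthonormal ℂ v :=
    hAs.orthogonalFamily_eigenspaces.orthonormal_sigma_orthonormal fun z => (c z).orthonormal
  have hsp : (Submodule.span ℂ (Set.range v))ᗮ = ⊥ := by
    rw [← le_bot_iff, ← hbot]
    intro x hx
    rw [Submodule.mem_orthogonal'] at hx ⊢
    refine fun u hu => Submodule.iSup_induction E (motive := fun u => ⟪x, u⟫_ℂ = 0) hu
      (fun z y hy => ?_) (by simp) (fun y y' hy hy' => by rw [inner_add_right, hy, hy', add_zero])
    have h1 := (((c z).hasSum_repr ⟨y, hy⟩).mapL (E z).subtypeL).mapL (innerSL ℂ x)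
    refine h1.unique ?_
    convert hasSum_zero using 2 with e
    have : ⟪x, (c z e : H)⟫_ℂ = 0 := hx _ (Submodule.subset_span ⟨⟨z, e⟩, rfl⟩)
    simp [this]
  refine ⟨_, HilbertBasis.mkOfOrthogonalEqBot hv hsp, fun j => ‖T (v j)‖,
    fun j => norm_nonneg _, fun j => ?_⟩
  rw [HilbertBasis.coe_mkOfOrthogonalEqBot]
  have hj : A (v j) = j.1 • v j := Module.End.mem_eigenspace_iff.1 (c j.1 j.2).2
  -- This identifies the eigenvalue as `‖T (v j)‖ ^ 2`, in particular real and nonnegative.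
  have h2 : ⟪v j, A (v j)⟫_ℂ = ((‖T (v j)‖ ^ 2 : ℝ) : ℂ) := by
    change ⟪v j, (star T) (T (v j))⟫_ℂ = _
    rw [ContinuousLinearMap.star_eq_adjoint, ContinuousLinearMap.adjoint_inner_right,
      inner_self_eq_norm_sq_to_K]
    push_cast
    rfl
  rw [hj, inner_smul_right, inner_self_eq_norm_sq_to_K, hv.1 j] at h2
  change A (v j) = _
  rw [hj, ← h2]
  simp

end SingularValues
-- Hölder for sums, Parseval and basis independence of the trace
theorem tsum_mul_rpow_le_tsum_rpow_mul {J : Type*} (f g : J → ℝ≥0∞) {p q : ℝ} (hp : 0 ≤ p) (hq : 0 ≤ q)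
    (hpq : p + q = 1) : ∑' j, f j ^ p * g j ^ q ≤ (∑' j, f j) ^ p * (∑' j, g j) ^ q := by
  let _ : MeasurableSpace J := ⊤
  simpa only [lintegral_count] using
    ENNReal.lintegral_mul_norm_pow_le (μ := Measure.count) (f := f) (g := g)
      measurable_from_top.aemeasurable measurable_from_top.aemeasurable hp hq hpq

section Parseval

variable {H : Type*} [NormedAddCommGroup H] [InnerProductSpace ℂ H]

theorem tsum_enorm_inner_sq {J : Type*} (b : HilbertBasis J ℂ H) (x : H) :
    ∑' j, ‖⟪b j, x⟫_ℂ‖ₑ ^ 2 = ‖x‖ₑ ^ 2 := by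
  have h := hasSum_norm_inner_sq b x
  have h2 := ENNReal.ofReal_tsum_of_nonneg (fun j => sq_nonneg ‖⟪b j, x⟫_ℂ‖) h.summable
  rw [h.tsum_eq] at h2
  simpa only [ENNReal.ofReal_pow (norm_nonneg _), ofReal_norm] using h2.symm

variable [CompleteSpace H] {J K : Type*}

theorem tsum_enorm_apply_sq_eq_adjoint (T : H →L[ℂ] H) (b : HilbertBasis J ℂ H)
    (c : HilbertBasis K ℂ H) : ∑' j, ‖T (b j)‖ₑ ^ 2 = ∑' k, ‖star T (c k)‖ₑ ^ 2 := by
  simp_rw [← tsum_enorm_inner_sq c (T _), ← tsum_enorm_inner_sq b (star T _)]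
  rw [ENNReal.tsum_comm]
  refine tsum_congr fun k => tsum_congr fun j => ?_
  rw [ContinuousLinearMap.star_eq_adjoint, ContinuousLinearMap.adjoint_inner_right,
    ← inner_conj_symm (c k), RCLike.enorm_conj]

/-- The Hilbert–Schmidt norm does not depend on the orthonormal basis. -/
theorem tsum_enorm_apply_sq_eq (T : H →L[ℂ] H) (b : HilbertBasis J ℂ H)
    (c : HilbertBasis K ℂ H) : ∑' j, ‖T (b j)‖ₑ ^ 2 = ∑' k, ‖T (c k)‖ₑ ^ 2 :=
  (tsum_enorm_apply_sq_eq_adjoint T b b).trans (tsum_enorm_apply_sq_eq_adjoint T c b).symm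

/-- The trace of `A` is the squared Hilbert–Schmidt norm of its square root, which does not depend
on the basis. -/
theorem positiveTrace_eq {A : H →L[ℂ] H} (hA : 0 ≤ A) (b : HilbertBasis J ℂ H) :
    positiveTrace A = ∑' j, ENNReal.ofReal (RCLike.re ⟪b j, A (b j)⟫_ℂ) := by
  have key : ∀ x : H, ENNReal.ofReal (RCLike.re ⟪x, A x⟫_ℂ) = ‖CFC.sqrt A x‖ₑ ^ 2 := fun x => by
    have hsa : star (CFC.sqrt A) = CFC.sqrt A := (CFC.sqrt_nonneg A).isSelfAdjoint.star_eq
    have h1 : ⟪x, A x⟫_ℂ = ⟪CFC.sqrt A x, CFC.sqrt A x⟫_ℂ := by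
      have h2 : ⟪CFC.sqrt A x, CFC.sqrt A x⟫_ℂ = ⟪x, star (CFC.sqrt A) (CFC.sqrt A x)⟫_ℂ :=
        (ContinuousLinearMap.adjoint_inner_right _ _ _).symm
      rw [h2, hsa, ← mul_apply_eq_comp, CFC.sqrt_mul_sqrt_self A hA]
    rw [h1, inner_self_eq_norm_sq, ENNReal.ofReal_pow (norm_nonneg _), ofReal_norm]
  simp only [positiveTrace, key]
  exact tsum_enorm_apply_sq_eq _ _ _

end Parseval

/-! ### Functional calculus on eigenvectors and McCarthy's inequality -/

section FunctionalCalculus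

variable {H : Type*} [NormedAddCommGroup H] [InnerProductSpace ℂ H] [CompleteSpace H]

/-- Stone–Weierstrass: the functions satisfying the identity include the constants and the
coordinate, and are closed under algebra operations and uniform limits. The eigenvalue `r` lies in
the spectrum, so evaluation there makes sense. -/
theorem cfc_apply_eigenvector {A : H →L[ℂ] H} (hA : IsSelfAdjoint A) {x : H} {r : ℝ}
    (hx : A x = (r : ℂ) • x) (hx0 : x ≠ 0) {f : ℝ → ℝ} (hf : ContinuousOn f (spectrum ℝ A)) :
    cfc f A x = (f r : ℂ) • x := by
  have hr : r ∈ spectrum ℝ A := by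
    rw [spectrum.mem_iff]
    intro hu
    obtain ⟨B, hB⟩ := hu.exists_left_inv
    have h1 : (algebraMap ℝ (H →L[ℂ] H) r - A) x = 0 := by
      rw [sub_apply, hx, Algebra.algebraMap_eq_smul_one]
      simp
    apply hx0
    have := congrArg (fun C : H →L[ℂ] H => C x) hB
    simpa [mul_apply_eq_comp, h1] using this.symm
  have key : ∀ g : C(spectrum ℝ A, ℝ), cfcHom hA g x = (g ⟨r, hr⟩ : ℂ) • x := fun g => by
    induction g using ContinuousMap.induction_on_of_compact with
    | const a =>
      have : cfcHom hA (ContinuousMap.const (spectrum ℝ A) a) = algebraMap ℝ (H →L[ℂ] H) a :=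
        AlgHomClass.commutes (cfcHom hA) a
      rw [this, Algebra.algebraMap_eq_smul_one]
      simp
    | id =>
      rw [cfcHom_id hA]
      exact hx
    | star_id =>
      rw [map_star, cfcHom_id, hA.star_eq]
      exact hx
    | add g g' hg hg' =>
      rw [map_add, add_apply, hg, hg', ← add_smul]
      simp
    | mul g g' hg hg' =>
      rw [map_mul, mul_apply_eq_comp, hg', map_smul, hg, smul_smul]
      simp [mul_comm]
    | frequently g hg =>
      have hcl : IsClosed {g : C(spectrum ℝ A, ℝ) | cfcHom hA g x = (g ⟨r, hr⟩ : ℂ) • x} := by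
        refine isClosed_eq ?_ ?_
        · exact (ContinuousLinearMap.apply ℂ H x).continuous.comp (cfcHom_continuous hA)
        · exact (Complex.continuous_ofReal.comp
            (continuous_eval_const _)).smul continuous_const
      exact hcl.closure_subset (mem_closure_iff_frequently.2 hg)
  rw [cfc_apply f A hA hf]
  exact key _

variable {T : H →L[ℂ] H}

theorem abs_rpow_apply_eigenvector {x : H} {t s : ℝ} (ht : 0 ≤ t) (hs : 0 ≤ s)
    (hx : (star T * T) x = ((t ^ 2 : ℝ) : ℂ) • x) (hx0 : x ≠ 0) :
    (CFC.abs T ^ s) x = ((t ^ s : ℝ) : ℂ) • x := by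
  have hpos : (0 : H →L[ℂ] H) ≤ star T * T := star_mul_self_nonneg T
  have habs : CFC.abs T x = (t : ℂ) • x := by
    rw [CFC.abs, CFC.sqrt_eq_real_sqrt _ hpos, cfcₙ_eq_cfc Real.continuous_sqrt.continuousOn
      Real.sqrt_zero, cfc_apply_eigenvector hpos.isSelfAdjoint hx hx0
      Real.continuous_sqrt.continuousOn, Real.sqrt_sq ht]
  rw [CFC.rpow_eq_cfc_real (CFC.abs_nonneg T)]
  exact cfc_apply_eigenvector (CFC.abs_nonneg T).isSelfAdjoint habs hx0
    (Real.continuous_rpow_const hs).continuousOn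

variable {J K : Type*}

theorem IsSingularBasis.positiveTrace_abs_rpow {b : HilbertBasis J ℂ H} {t : J → ℝ}
    (hb : IsSingularBasis T b t) {s : ℝ} (hs : 0 ≤ s) :
    positiveTrace (CFC.abs T ^ s) = ∑' j, ENNReal.ofReal (t j) ^ s := by
  rw [positiveTrace_eq CFC.rpow_nonneg b]
  refine tsum_congr fun j => ?_
  have hne : b j ≠ 0 := b.orthonormal.ne_zero j
  rw [abs_rpow_apply_eigenvector (hb.nonneg j) hs (hb.apply_eq j) hne, inner_smul_right,
    inner_self_eq_norm_sq_to_K, b.orthonormal.1 j, ENNReal.ofReal_rpow_of_nonneg (hb.nonneg j) hs]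
  congr 1
  simp only [RCLike.ofReal_one, one_pow, mul_one]
  exact Complex.ofReal_re _

/-- McCarthy's inequality: for `s ≤ 2` the Schatten `s`-norm is at most the `ℓ^s`-norm of the
norms of the columns in any orthonormal basis. -/
theorem IsSingularBasis.tsum_rpow_le {b : HilbertBasis J ℂ H} {t : J → ℝ}
    (hb : IsSingularBasis T b t) (h : HilbertBasis K ℂ H) {s : ℝ} (hs : 0 < s) (hs2 : s ≤ 2) :
    ∑' j, ENNReal.ofReal (t j) ^ s ≤ ∑' m, ‖T (h m)‖ₑ ^ s := by
  have hT : ∀ x, ∑' j, ENNReal.ofReal (t j) ^ 2 * ‖⟪b j, x⟫_ℂ‖ₑ ^ 2 = ‖T x‖ₑ ^ 2 := fun x => by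
    have h1 := hb.hasSum_norm_apply_sq x
    have h2 := ENNReal.ofReal_tsum_of_nonneg
      (fun j => mul_nonneg (sq_nonneg (t j)) (sq_nonneg ‖⟪b j, x⟫_ℂ‖)) h1.summable
    rw [h1.tsum_eq] at h2
    simpa only [ENNReal.ofReal_mul (sq_nonneg _), ENNReal.ofReal_pow (norm_nonneg _),
      ENNReal.ofReal_pow (hb.nonneg _), ofReal_norm] using h2.symm
  -- Jensen's inequality for the concave power `s/2`, with weights `|⟪b j, h m⟫|²` of total mass
  -- one; it appears as Hölder with exponents `s/2` and `1 - s/2`.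
  have hm : ∀ m, ∑' j, ENNReal.ofReal (t j) ^ s * ‖⟪b j, h m⟫_ℂ‖ₑ ^ 2 ≤ ‖T (h m)‖ₑ ^ s := by
    intro m
    have h1 := tsum_mul_rpow_le_tsum_rpow_mul
      (fun j => ENNReal.ofReal (t j) ^ 2 * ‖⟪b j, h m⟫_ℂ‖ₑ ^ 2) (fun j => ‖⟪b j, h m⟫_ℂ‖ₑ ^ 2)
      (p := s / 2) (q := 1 - s / 2) (by positivity) (by linarith) (by ring)
    have h2 : ‖h m‖ₑ = 1 := by
      rw [← ofReal_norm, h.orthonormal.1 m, ENNReal.ofReal_one]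
    rw [hT, tsum_enorm_inner_sq, h2, one_pow, ENNReal.one_rpow, mul_one, ← ENNReal.rpow_natCast,
      ← ENNReal.rpow_mul] at h1
    have e1 : ((2 : ℕ) : ℝ) * (s / 2) = s := by
      push_cast
      ring
    rw [e1] at h1
    refine le_trans (le_of_eq (tsum_congr fun j => ?_)) h1
    rw [ENNReal.mul_rpow_of_nonneg _ _ (by positivity), mul_assoc,
      ← ENNReal.rpow_add_of_nonneg _ _ (by positivity) (by linarith),
      ← ENNReal.rpow_natCast (ENNReal.ofReal (t j)), ← ENNReal.rpow_mul, e1]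
    simp
  calc ∑' j, ENNReal.ofReal (t j) ^ s
      = ∑' j, ∑' m, ENNReal.ofReal (t j) ^ s * ‖⟪b j, h m⟫_ℂ‖ₑ ^ 2 := by
        refine tsum_congr fun j => ?_
        have h3 : ∀ m, ‖⟪b j, h m⟫_ℂ‖ₑ = ‖⟪h m, b j⟫_ℂ‖ₑ := fun m => by
          rw [← inner_conj_symm, RCLike.enorm_conj]
        rw [ENNReal.tsum_mul_left]
        simp only [h3]
        rw [tsum_enorm_inner_sq, ← ofReal_norm, b.orthonormal.1 j]
        simp
    _ = ∑' m, ∑' j, ENNReal.ofReal (t j) ^ s * ‖⟪b j, h m⟫_ℂ‖ₑ ^ 2 := ENNReal.tsum_comm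
    _ ≤ ∑' m, ‖T (h m)‖ₑ ^ s := ENNReal.tsum_le_tsum hm

end FunctionalCalculus

/-! ### Schatten bounds from the ideal; diagonal operators and operators with given columns -/

/-- Membership in `𝓛^{1,∞}` gives summability of the `s`-th powers of the singular values, with
a bound of order `(s - 1)⁻¹`. -/
theorem MemWeakTraceIdeal.exists_tsum_rpow_le {H : Type*} [NormedAddCommGroup H]
    [InnerProductSpace ℂ H] [CompleteSpace H] {J : Type*} {T : H →L[ℂ] H}
    (hT : MemWeakTraceIdeal T) {b : HilbertBasis J ℂ H} {t : J → ℝ} (hb : IsSingularBasis T b t) :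
    ∃ K : ℝ, 1 ≤ K ∧ ∀ s : ℝ, 1 < s → s ≤ 2 →
      ∑' j, ENNReal.ofReal (t j) ^ s ≤ ENNReal.ofReal (K / (s - 1)) := by
  obtain ⟨-, C, hC⟩ := hT
  set D := max C 1 with hD
  have hD1 : 1 ≤ D := le_max_right _ _
  have hbound : ∀ k : ℕ,
      ∑ n ∈ Finset.range k, singularValue T n ≤ D * Real.log (1 + (k : ℝ)) := fun k => by
    rcases Nat.eq_zero_or_pos k with rfl | hk
    · simp
    have hk' : (1 : ℝ) ≤ k := by exact_mod_cast hk
    have hlog : 0 < Real.log (1 + (k : ℝ)) := Real.log_pos (by linarith)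
    have h1 := (hC k hk).trans (le_max_left C 1)
    rwa [inv_mul_le_iff₀ hlog, mul_comm] at h1
  -- Since `D ≥ 1` and `s ≤ 2`, this constant dominates `D^s * s` uniformly in `s`.
  refine ⟨D ^ (2 : ℝ) * 2, ?_, fun s hs hs2 => ?_⟩
  · have : 1 ≤ D ^ (2 : ℝ) := Real.one_le_rpow hD1 (by norm_num)
    linarith
  · have hs1 : 0 < s - 1 := by linarith
    refine ENNReal.summable.tsum_le_of_sum_le fun S => ?_
    have h1 := hb.sum_rpow_le_of_log_bound (zero_le_one.trans hD1) hbound hs S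
    have h2 : ∑ j ∈ S, ENNReal.ofReal (t j) ^ s = ENNReal.ofReal (∑ j ∈ S, t j ^ s) := by
      rw [ENNReal.ofReal_sum_of_nonneg fun j _ => Real.rpow_nonneg (hb.nonneg j) s]
      exact Finset.sum_congr rfl fun j _ => ENNReal.ofReal_rpow_of_nonneg (hb.nonneg j) (by linarith)
    rw [h2]
    refine ENNReal.ofReal_le_ofReal (h1.trans ?_)
    rw [mul_div_assoc]
    have h3 : D ^ s ≤ D ^ (2 : ℝ) := Real.rpow_le_rpow_of_exponent_le hD1 hs2
    gcongr

/-- Distinct basis vectors are at distance `√2`, so balls of radius `1/2` are disjoint. Countability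
permits exchanging sum and integral for `μ_s`. -/
theorem countable_index_of_hilbertBasis {H ι : Type*} [NormedAddCommGroup H] [InnerProductSpace ℂ H]
    [TopologicalSpace.SeparableSpace H] (h : HilbertBasis ι ℂ H) : Countable ι := by
  refine Pairwise.countable_of_isOpen_disjoint (s := fun i => Metric.ball (h i) (1 / 2))
    (fun i j hij => Metric.ball_disjoint_ball ?_) (fun _ => Metric.isOpen_ball)
    (fun i => ⟨h i, Metric.mem_ball_self (by norm_num)⟩)
  have h1 : ‖h i - h j‖ ^ 2 = 2 := by
    have h2 := norm_sub_sq (𝕜 := ℂ) (h i) (h j)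
    rw [h.orthonormal.2 hij, h.orthonormal.1 i, h.orthonormal.1 j] at h2
    rw [h2]
    norm_num
  rw [dist_eq_norm]
  nlinarith [norm_nonneg (h i - h j)]

theorem isSingularBasis_diagonalOperator {H ι : Type*} [NormedAddCommGroup H]
    [InnerProductSpace ℂ H] [CompleteSpace H] (b : HilbertBasis ι ℂ H) (c : ι → ℂ)
    (hc : ∃ C : ℝ, ∀ i, ‖c i‖ ≤ C) :
    IsSingularBasis (diagonalOperator b c hc) b fun i => ‖c i‖ := by
  classical
  refine ⟨fun i => norm_nonneg _, fun i => ?_⟩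
  apply b.repr.injective
  ext j
  rw [b.repr_apply_apply, b.repr_apply_apply, ContinuousLinearMap.star_eq_adjoint,
    mul_apply_eq_comp, ContinuousLinearMap.adjoint_inner_right, diagonalOperator_apply_basis,
    diagonalOperator_apply_basis, inner_smul_left, inner_smul_right, inner_smul_right,
    orthonormal_iff_ite.1 b.orthonormal]
  split_ifs with hij
  · subst hij
    rw [mul_one, mul_one, ← Complex.normSq_eq_conj_mul_self, Complex.normSq_eq_norm_sq]
  · simp

/-- The rank-one operators `x ↦ ⟪h i, x⟫ v i` sum in operator norm, by Cauchy–Schwarz and Bessel,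
and a norm limit of finite-rank operators is compact. -/
theorem exists_isCompactOperator_of_summable {H ι : Type*} [NormedAddCommGroup H]
    [InnerProductSpace ℂ H] [CompleteSpace H] (h : HilbertBasis ι ℂ H) (v : ι → H)
    (hv : Summable fun i => ‖v i‖ ^ 2) :
    ∃ T : H →L[ℂ] H, IsCompactOperator T ∧ ∀ i, T (h i) = v i := by
  classical
  let A : ι → H →L[ℂ] H := fun i => (innerSL ℂ (h i)).smulRight (v i)
  have hA : ∀ i x, A i x = ⟪h i, x⟫_ℂ • v i := fun i x => rfl
  have hnorm : ∀ S : Finset ι, ‖∑ i ∈ S, A i‖ ^ 2 ≤ ∑ i ∈ S, ‖v i‖ ^ 2 := fun S => by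
    have h0 : 0 ≤ ∑ i ∈ S, ‖v i‖ ^ 2 := Finset.sum_nonneg fun i _ => sq_nonneg _
    rw [← Real.sq_sqrt h0]
    refine pow_le_pow_left₀ (norm_nonneg _) ?_ 2
    refine ContinuousLinearMap.opNorm_le_bound _ (Real.sqrt_nonneg _) fun x => ?_
    refine le_of_sq_le_sq ?_ (by positivity)
    rw [mul_pow, Real.sq_sqrt h0, sum_apply]
    have h1 : ‖∑ i ∈ S, A i x‖ ≤ ∑ i ∈ S, ‖v i‖ * ‖⟪h i, x⟫_ℂ‖ :=
      (norm_sum_le _ _).trans_eq (Finset.sum_congr rfl fun i _ => by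
        rw [hA, norm_smul, mul_comm])
    refine (pow_le_pow_left₀ (norm_nonneg _) h1 2).trans
      ((Finset.sum_mul_sq_le_sq_mul_sq S _ _).trans ?_)
    refine mul_le_mul_of_nonneg_left ?_ h0
    have h2 := hasSum_norm_inner_sq h x
    exact sum_le_hasSum S (fun i _ => sq_nonneg _) h2
  have hsum : Summable A := by
    rw [summable_iff_vanishing_norm]
    intro ε hε
    obtain ⟨S, hS⟩ := summable_iff_vanishing_norm.1 hv (ε ^ 2) (by positivity)
    refine ⟨S, fun S' hS' => ?_⟩
    have h1 := (hnorm S').trans_lt ((le_abs_self _).trans_lt (hS S' hS'))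
    exact lt_of_pow_lt_pow_left₀ 2 hε.le h1
  refine ⟨∑' i, A i, isCompactOperator_of_tendsto hsum.hasSum (.of_forall fun S => ?_), fun i => ?_⟩
  · induction S using Finset.induction_on with
    | empty => simpa using isCompactOperator_zero
    | insert i S hi ih =>
      rw [Finset.sum_insert hi]
      refine IsCompactOperator.add ?_ ih
      have : IsCompactOperator (innerSL ℂ (h i)) :=
        isCompactOperator_of_locallyCompactSpace_dom (innerSL ℂ (h i))
      exact this.clm_comp ((ContinuousLinearMap.id ℂ ℂ).smulRight (v i))
  · have h1 : HasSum (fun j => A j (h i)) ((∑' j, A j) (h i)) :=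
      hsum.hasSum.mapL (ContinuousLinearMap.apply ℂ H (h i))
    refine h1.unique ?_
    have h2 : ∀ j, j ≠ i → A j (h i) = 0 := fun j hj => by
      rw [hA, h.orthonormal.2 hj, zero_smul]
    have h3 : A i (h i) = v i := by
      rw [hA, inner_self_eq_norm_sq_to_K, h.orthonormal.1 i]
      simp
    rw [← h3]
    exact hasSum_single i h2

/-! ### Closedness of `T_f B` and its bounded closure -/

section Closure

variable {H F : Type*} [NormedAddCommGroup H] [InnerProductSpace ℂ H]
  [MeasurableSpace F] {μ : Measure F} (U : H ≃ₗᵢ[ℂ] Lp ℂ 2 μ) (f : F → ℂ) (B : H →L[ℂ] H)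

theorem mem_graph_compBounded_iff {x y : H} :
    (x, y) ∈ (compBounded (multiplicationOperator U f) B).graph ↔
      (fun t => f t * U (B x) t) =ᵐ[μ] U y := by
  rw [LinearPMap.mem_graph_iff]
  constructor
  · rintro ⟨z, hz, hy⟩
    obtain ⟨z, hzd⟩ := z
    obtain rfl : z = x := hz
    have hm : MemLp (fun t => f t * U (B z) t) 2 μ := hzd
    have hy' : U.symm (hm.toLp _) = y := hy
    rw [← hy', U.apply_symm_apply]
    exact hm.coeFn_toLp.symm
  · intro hxy
    have hm : MemLp (fun t => f t * U (B x) t) 2 μ := (memLp_congr_ae hxy).2 (Lp.memLp _)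
    refine ⟨⟨x, hm⟩, rfl, ?_⟩
    change U.symm (hm.toLp _) = y
    rw [LinearIsometryEquiv.symm_apply_eq]
    exact Lp.ext (hm.coeFn_toLp.trans hxy)

theorem isClosed_compBounded_multiplicationOperator :
    (compBounded (multiplicationOperator U f) B).IsClosed := by
  refine IsSeqClosed.isClosed fun p q hp hpq => ?_
  obtain ⟨x, y⟩ := q
  have hx : Tendsto (fun n => U (B (p n).1)) atTop (𝓝 (U (B x))) :=
    ((U.continuous.comp B.continuous).tendsto x).comp hpq.fst_nhds
  have hy : Tendsto (fun n => U (p n).2) atTop (𝓝 (U y)) :=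
    (U.continuous.tendsto y).comp hpq.snd_nhds
  obtain ⟨a, ha, hax⟩ := (tendstoInMeasure_of_tendsto_Lp hx).exists_seq_tendsto_ae
  -- A second extraction along the first subsequence gives almost everywhere convergence of both
  -- components at once.
  obtain ⟨c, hc, hcy⟩ := (tendstoInMeasure_of_tendsto_Lp
    (hy.comp ha.tendsto_atTop)).exists_seq_tendsto_ae
  have hrel : ∀ᵐ t ∂μ, ∀ n, f t * U (B (p n).1) t = U (p n).2 t :=
    ae_all_iff.2 fun n => (mem_graph_compBounded_iff U f B).1 (hp n)
  refine (mem_graph_compBounded_iff U f B).2 ?_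
  filter_upwards [hax, hcy, hrel] with t h1 h2 h3
  refine tendsto_nhds_unique ((h1.comp hc.tendsto_atTop).const_mul (f t)) ?_
  refine h2.congr fun n => ?_
  exact (h3 _).symm

/-- The product is already closed, so its closure can be everywhere defined only if its natural
domain is all of `H`. -/
theorem hasBoundedClosure_iff {T : H →L[ℂ] H} :
    HasBoundedClosure (compBounded (multiplicationOperator U f) B) T ↔
      ∀ x, (fun t => f t * U (B x) t) =ᵐ[μ] U (T x) := by
  have hcl := isClosed_compBounded_multiplicationOperator U f B
  have hclos : (compBounded (multiplicationOperator U f) B).closure =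
      compBounded (multiplicationOperator U f) B :=
    LinearPMap.eq_of_eq_graph (by
      rw [← hcl.isClosable.graph_closure_eq_closure_graph]
      exact IsClosed.submodule_topologicalClosure_eq hcl)
  constructor
  · rintro ⟨-, -, h⟩ x
    rw [hclos] at h
    rw [← mem_graph_compBounded_iff, h, LinearPMap.mem_graph_iff]
    exact ⟨⟨x, trivial⟩, rfl, rfl⟩
  · intro h
    have hdom : (compBounded (multiplicationOperator U f) B).domain = ⊤ :=
      eq_top_iff.2 fun x _ => LinearPMap.mem_domain_of_mem_graph
        ((mem_graph_compBounded_iff U f B).2 (h x))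
    refine ⟨by simp [hdom], hcl.isClosable, ?_⟩
    rw [hclos]
    refine LinearPMap.ext hdom fun x hx _ => ?_
    exact ((LinearPMap.image_iff hx).2 ((mem_graph_compBounded_iff U f B).2 (h x))).symm

/-- It is enough to know the product of `T_f` and a bounded operator on an orthonormal basis. -/
theorem hasBoundedClosure_of_basis {ι : Type*} (h : HilbertBasis ι ℂ H) {T : H →L[ℂ] H}
    (hT : ∀ m, (fun t => f t * U (B (h m)) t) =ᵐ[μ] U (T (h m))) :
    HasBoundedClosure (compBounded (multiplicationOperator U f) B) T := by
  rw [hasBoundedClosure_iff]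
  let S : Submodule ℂ H := (compBounded (multiplicationOperator U f) B).graph.comap
    (LinearMap.prod LinearMap.id (T : H →ₗ[ℂ] H))
  have hScl : IsClosed (S : Set H) :=
    (isClosed_compBounded_multiplicationOperator U f B).preimage
      (continuous_id.prodMk T.continuous)
  have hspan : (Submodule.span ℂ (Set.range h)).topologicalClosure ≤ S := by
    refine Submodule.topologicalClosure_minimal _ (Submodule.span_le.2 ?_) hScl
    rintro _ ⟨m, rfl⟩
    exact (mem_graph_compBounded_iff U f B).2 (hT m)
  intro x
  have hx : x ∈ S := hspan (h.dense_span ▸ Submodule.mem_top)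
  exact (mem_graph_compBounded_iff U f B).1 hx

end Closure

/-! ### The measures `μ_s` and the columns of `T_f G(D)` -/

section SpectralMeasure

variable {H F ι : Type*} [NormedAddCommGroup H] [InnerProductSpace ℂ H]
  [MeasurableSpace F] {μ : Measure F} (U : H ≃ₗᵢ[ℂ] Lp ℂ 2 μ) (h : HilbertBasis ι ℂ H)
  (ev : ι → ℝ) (G : ℝ → ℂ) {f : F → ℂ}

theorem enorm_sq_eq_lintegral (g : Lp ℂ 2 μ) : ‖g‖ₑ ^ 2 = ∫⁻ t, ‖g t‖ₑ ^ 2 ∂μ := by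
  rw [Lp.enorm_def, eLpNorm_eq_lintegral_rpow_enorm_toReal two_ne_zero ENNReal.ofNat_ne_top,
    ← ENNReal.rpow_natCast, ← ENNReal.rpow_mul]
  simp

theorem eLpNorm_spectralMeasure_sq [Countable ι] (hf : AEStronglyMeasurable f μ) {s : ℝ}
    (hs : 0 ≤ s) :
    eLpNorm f 2 (spectralMeasure U h ev G s) ^ 2 =
      ∑' m, ‖G (ev m)‖ₑ ^ s * ∫⁻ t, ‖f t‖ₑ ^ 2 * ‖U (h m) t‖ₑ ^ 2 ∂μ := by
  have hU : ∀ m, AEMeasurable (fun t => ‖U (h m) t‖ₑ ^ 2) μ := fun m =>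
    (Lp.aestronglyMeasurable (U (h m))).enorm.pow_const 2
  have hf2 : AEMeasurable (fun t => ‖f t‖ₑ ^ 2) μ := hf.enorm.pow_const 2
  have hden : ∀ t, ∑' m, ENNReal.ofReal (‖G (ev m)‖ ^ s * ‖U (h m) t‖ ^ 2) =
      ∑' m, ‖G (ev m)‖ₑ ^ s * ‖U (h m) t‖ₑ ^ 2 := fun t => tsum_congr fun m => by
    rw [ENNReal.ofReal_mul (by positivity), ← ENNReal.ofReal_rpow_of_nonneg (norm_nonneg _) hs,
      ENNReal.ofReal_pow (norm_nonneg _), ofReal_norm, ofReal_norm]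
  have hterm : ∀ m, AEMeasurable (fun t => ‖G (ev m)‖ₑ ^ s * ‖U (h m) t‖ₑ ^ 2) μ := fun m =>
    (hU m).const_mul _
  have hsq : eLpNorm f 2 (spectralMeasure U h ev G s) ^ 2 =
      ∫⁻ t, ‖f t‖ₑ ^ 2 ∂(spectralMeasure U h ev G s) := by
    rw [eLpNorm_eq_lintegral_rpow_enorm_toReal two_ne_zero ENNReal.ofNat_ne_top,
      ← ENNReal.rpow_natCast, ← ENNReal.rpow_mul]
    simp
  rw [hsq, spectralMeasure]
  simp only [hden]
  rw [lintegral_withDensity_eq_lintegral_mul₀ (AEMeasurable.tsum hterm) hf2]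
  simp only [Pi.mul_apply, ← ENNReal.tsum_mul_right]
  have hprod : ∀ m, AEMeasurable
      (fun t => ‖G (ev m)‖ₑ ^ s * ‖U (h m) t‖ₑ ^ 2 * ‖f t‖ₑ ^ 2) μ := fun m => (hterm m).mul hf2
  rw [lintegral_tsum hprod]
  refine tsum_congr fun m => ?_
  have hm : AEMeasurable (fun t => ‖f t‖ₑ ^ 2 * ‖U (h m) t‖ₑ ^ 2) μ := hf2.mul (hU m)
  rw [← lintegral_const_mul'' _ hm]
  refine lintegral_congr fun t => ?_
  ring

theorem lintegral_mul_functionOf_basis (hGbdd : ∃ C : ℝ, ∀ x, ‖G x‖ ≤ C)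
    (hf : AEStronglyMeasurable f μ) (m : ι) :
    ∫⁻ t, ‖f t * U (functionOf G hGbdd h ev (h m)) t‖ₑ ^ 2 ∂μ =
      ‖G (ev m)‖ₑ ^ 2 * ∫⁻ t, ‖f t‖ₑ ^ 2 * ‖U (h m) t‖ₑ ^ 2 ∂μ := by
  have hm : AEMeasurable (fun t => ‖f t‖ₑ ^ 2 * ‖U (h m) t‖ₑ ^ 2) μ :=
    (hf.enorm.pow_const 2).mul ((Lp.aestronglyMeasurable (U (h m))).enorm.pow_const 2)
  rw [← lintegral_const_mul'' _ hm, functionOf,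
    diagonalOperator_apply_basis, map_smul]
  refine lintegral_congr_ae ?_
  filter_upwards [Lp.coeFn_smul (G (ev m)) (U (h m))] with t ht
  rw [ht, Pi.smul_apply, smul_eq_mul, enorm_mul, enorm_mul]
  ring

theorem enorm_sq_of_ae_eq (hGbdd : ∃ C : ℝ, ∀ x, ‖G x‖ ≤ C)
    (hf : AEStronglyMeasurable f μ) {m : ι} {y : H}
    (hy : (fun t => f t * U (functionOf G hGbdd h ev (h m)) t) =ᵐ[μ] U y) :
    ‖y‖ₑ ^ 2 = ‖G (ev m)‖ₑ ^ 2 * ∫⁻ t, ‖f t‖ₑ ^ 2 * ‖U (h m) t‖ₑ ^ 2 ∂μ := by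
  have h1 : ‖y‖ₑ = ‖U y‖ₑ := by
    rw [← ofReal_norm, ← ofReal_norm, U.norm_map]
  rw [← lintegral_mul_functionOf_basis U h ev G hGbdd hf m, h1, enorm_sq_eq_lintegral]
  refine lintegral_congr_ae ?_
  filter_upwards [hy] with t ht
  rw [← ht]

theorem memLp_mul_functionOf_basis (hGbdd : ∃ C : ℝ, ∀ x, ‖G x‖ ≤ C)
    (hf : AEStronglyMeasurable f μ) {m : ι}
    (hfin : ‖G (ev m)‖ₑ ^ 2 * ∫⁻ t, ‖f t‖ₑ ^ 2 * ‖U (h m) t‖ₑ ^ 2 ∂μ < ∞) :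
    MemLp (fun t => f t * U (functionOf G hGbdd h ev (h m)) t) 2 μ := by
  refine ⟨hf.mul (Lp.aestronglyMeasurable _), ?_⟩
  rw [eLpNorm_lt_top_iff_lintegral_rpow_enorm_lt_top two_ne_zero ENNReal.ofNat_ne_top]
  rw [← lintegral_mul_functionOf_basis U h ev G hGbdd hf m] at hfin
  simpa using hfin

end SpectralMeasure

/-! ### Hölder interpolation and the limit `s → 1⁺` -/

section Interpolation

/-- Hölder's inequality with exponents `2 / s` and `2 / (2 - s)`, for the columns of a product. -/
theorem tsum_rpow_le_of_sq_eq {ι : Type*} {x g α : ι → ℝ≥0∞} (hx : ∀ m, x m ^ 2 = g m ^ 2 * α m)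
    {s : ℝ} (hs : 1 < s) (hs2 : s ≤ 2) :
    ∑' m, x m ^ s ≤ (∑' m, g m ^ s * α m) ^ (s / 2) * (∑' m, g m ^ s) ^ (1 - s / 2) := by
  refine le_trans (le_of_eq (tsum_congr fun m => ?_)) (tsum_mul_rpow_le_tsum_rpow_mul
    (fun m => g m ^ s * α m) (fun m => g m ^ s) (p := s / 2) (q := 1 - s / 2) (by positivity)
    (by linarith) (by ring))
  have h2 : ((2 : ℕ) : ℝ) * (s / 2) = s := by
    push_cast
    ring
  have h1 : x m ^ s = (x m ^ 2) ^ (s / 2) := by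
    rw [← ENNReal.rpow_natCast, ← ENNReal.rpow_mul, h2]
  rw [h1, hx, ENNReal.mul_rpow_of_nonneg _ _ (by positivity),
    ENNReal.mul_rpow_of_nonneg _ _ (by positivity), mul_right_comm,
    ← ENNReal.rpow_add_of_nonneg _ _ (by positivity) (by linarith),
    ← ENNReal.rpow_natCast, ← ENNReal.rpow_mul, h2]
  simp

theorem rpow_one_div_le_of_le {N e Γ : ℝ≥0∞} {s : ℝ} (hs : 1 < s)
    (h : N ≤ (e ^ 2) ^ (s / 2) * Γ ^ (1 - s / 2)) :
    N ^ (1 / s) ≤ e * Γ ^ (1 / s - 1 / 2) := by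
  have hs0 : 0 < s := by linarith
  refine (ENNReal.rpow_le_rpow h (by positivity)).trans (le_of_eq ?_)
  rw [ENNReal.mul_rpow_of_nonneg _ _ (by positivity), ← ENNReal.rpow_natCast, ← ENNReal.rpow_mul,
    ← ENNReal.rpow_mul, ← ENNReal.rpow_mul]
  have e1 : ((2 : ℕ) : ℝ) * (s / 2 * (1 / s)) = 1 := by
    push_cast
    field_simp
  have e2 : (1 - s / 2) * (1 / s) = 1 / s - 1 / 2 := by
    field_simp
  rw [e1, e2, ENNReal.rpow_one]

/-- Each of the two factors contributes at most a multiple of `(s-1)^(-1/2)`. -/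
theorem rpow_one_div_le_of_bounds {N e Γ W : ℝ≥0∞} {s K : ℝ} (hs : 1 < s) (hs2 : s ≤ 2)
    (hN : N ^ (1 / s) ≤ e * Γ ^ (1 / s - 1 / 2)) (he : ENNReal.ofReal (s - 1) ^ (1 / 2 : ℝ) * e ≤ W)
    (hW : W ≠ ∞) (hK : 1 ≤ K) (hΓ : Γ ≤ ENNReal.ofReal (K / (s - 1))) :
    N ^ (1 / s) ≤ ENNReal.ofReal (W.toReal * K / (s - 1)) := by
  have hs1 : 0 < s - 1 := by linarith
  have hs0 : 0 < s := by linarith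
  have hp : 0 ≤ 1 / s - 1 / 2 := by
    rw [sub_nonneg]
    exact one_div_le_one_div_of_le hs0 hs2
  have hp2 : 1 / s - 1 / 2 ≤ 1 / 2 := by
    have : 1 / s ≤ 1 := by
      rw [div_le_one hs0]
      exact hs.le
    linarith
  set d := ENNReal.ofReal (s - 1) with hd
  have hd0 : d ≠ 0 := (ENNReal.ofReal_pos.2 hs1).ne'
  have hdt : d ≠ ∞ := ENNReal.ofReal_ne_top
  have hbase : ENNReal.ofReal (K / (s - 1)) = ENNReal.ofReal K / d :=
    ENNReal.ofReal_div_of_pos hs1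
  -- A base at least `1` allows the exponent `1/s - 1/2` to be raised to `1/2`.
  have hone : 1 ≤ ENNReal.ofReal (K / (s - 1)) := by
    rw [← ENNReal.ofReal_one]
    refine ENNReal.ofReal_le_ofReal ?_
    rw [le_div_iff₀ hs1]
    linarith
  have h1 : Γ ^ (1 / s - 1 / 2) ≤ (ENNReal.ofReal K / d) ^ (1 / 2 : ℝ) :=
    (ENNReal.rpow_le_rpow hΓ hp).trans
      (hbase ▸ ENNReal.rpow_le_rpow_of_exponent_le hone hp2)
  have h2 : e ≤ W / d ^ (1 / 2 : ℝ) := by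
    rw [ENNReal.le_div_iff_mul_le (Or.inl (by simp [hd0, hdt])) (Or.inl (by simp [hd0, hdt])),
      mul_comm]
    exact he
  have h3 : (ENNReal.ofReal K) ^ (1 / 2 : ℝ) ≤ ENNReal.ofReal K := by
    conv_rhs => rw [← ENNReal.rpow_one (ENNReal.ofReal K)]
    refine ENNReal.rpow_le_rpow_of_exponent_le ?_ (by norm_num)
    rw [← ENNReal.ofReal_one]
    exact ENNReal.ofReal_le_ofReal hK
  calc N ^ (1 / s) ≤ e * Γ ^ (1 / s - 1 / 2) := hN
    _ ≤ W / d ^ (1 / 2 : ℝ) * (ENNReal.ofReal K / d) ^ (1 / 2 : ℝ) := mul_le_mul' h2 h1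
    _ ≤ W / d ^ (1 / 2 : ℝ) * (ENNReal.ofReal K / d ^ (1 / 2 : ℝ)) := by
        rw [ENNReal.div_rpow_of_nonneg _ _ (by norm_num)]
        gcongr
    _ = W * ENNReal.ofReal K / d := by
        have hdd : d⁻¹ = (d ^ (1 / 2 : ℝ))⁻¹ * (d ^ (1 / 2 : ℝ))⁻¹ := by
          rw [← ENNReal.rpow_neg, ← ENNReal.rpow_add _ _ hd0 hdt, ← ENNReal.rpow_neg_one]
          norm_num
        rw [div_eq_mul_inv W, div_eq_mul_inv (ENNReal.ofReal K), div_eq_mul_inv (W * _), hdd]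
        ring
    _ = ENNReal.ofReal (W.toReal * K / (s - 1)) := by
        rw [ENNReal.ofReal_div_of_pos hs1, ENNReal.ofReal_mul ENNReal.toReal_nonneg,
          ENNReal.ofReal_toReal hW]

theorem limsup_rpow_half {α : Type*} (l : Filter α) (u : α → ℝ≥0∞) :
    limsup (fun x => u x ^ (1 / 2 : ℝ)) l = limsup u l ^ (1 / 2 : ℝ) :=
  ((ENNReal.orderIsoRpow (1 / 2) (by norm_num)).limsup_apply (f := l) (u := u)).symm

/-- Compared with the square root of `Γ^(1/s)`, the exponent `1/s - 1/2` leaves an excess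
`-(s-1)/(2s)`. The lower bound `g^s ≤ Γ s` controls this negative power by `g^(-(s-1)/2)`, which
tends to `1`, so the constant in the estimate is exactly `1`. -/
theorem limsup_schatten_le {N e Γ : ℝ → ℝ≥0∞} {W g : ℝ≥0∞}
    (hN : ∀ s, 1 < s → s ≤ 2 → N s ^ (1 / s) ≤ e s * Γ s ^ (1 / s - 1 / 2))
    (he : ∀ s, 1 < s → s ≤ 2 → ENNReal.ofReal (s - 1) ^ (1 / 2 : ℝ) * e s ≤ W) (hW : W ≠ ∞)
    (hΓ : ∀ s, 1 < s → s ≤ 2 → Γ s ≠ ∞)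
    (hg : ∀ s, 1 < s → s ≤ 2 → g ^ s ≤ Γ s) (hg0 : g ≠ 0) (hgt : g ≠ ∞) :
    limsup (fun s => ENNReal.ofReal (s - 1) * N s ^ (1 / s)) (𝓝[>] (1 : ℝ)) ≤
      W * limsup (fun s => ENNReal.ofReal (s - 1) * Γ s ^ (1 / s)) (𝓝[>] (1 : ℝ)) ^
        (1 / 2 : ℝ) := by
  let X : ℝ → ℝ≥0∞ := fun s => (ENNReal.ofReal (s - 1) * Γ s ^ (1 / s)) ^ (1 / 2 : ℝ)
  let c : ℝ → ℝ≥0∞ := fun s => g ^ (-(s - 1) / 2)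
  have hc : Tendsto c (𝓝[>] (1 : ℝ)) (𝓝 1) := by
    have h1 : Continuous fun s : ℝ => g.toReal ^ (-(s - 1) / 2) :=
      Real.continuous_const_rpow (ENNReal.toReal_pos hg0 hgt).ne' |>.comp (by fun_prop)
    have h2 : Tendsto (fun s : ℝ => ENNReal.ofReal (g.toReal ^ (-(s - 1) / 2))) (𝓝[>] (1 : ℝ))
        (𝓝 (ENNReal.ofReal (g.toReal ^ (-((1 : ℝ) - 1) / 2)))) :=
      (ENNReal.tendsto_ofReal (h1.tendsto 1)).mono_left nhdsWithin_le_nhds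
    simp only [sub_self, neg_zero, zero_div, Real.rpow_zero, ENNReal.ofReal_one] at h2
    refine h2.congr fun s => ?_
    rw [← ENNReal.ofReal_rpow_of_pos (ENNReal.toReal_pos hg0 hgt), ENNReal.ofReal_toReal hgt]
  have hev : ∀ᶠ s in 𝓝[>] (1 : ℝ),
      ENNReal.ofReal (s - 1) * N s ^ (1 / s) ≤ W * (X * c) s := by
    filter_upwards [Ioc_mem_nhdsGT (show (1 : ℝ) < 2 by norm_num)] with s hs
    obtain ⟨hs, hs2⟩ := hs
    have hs0 : 0 < s := by linarith
    set d := ENNReal.ofReal (s - 1) with hd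
    have hd0 : d ≠ 0 := (ENNReal.ofReal_pos.2 (by linarith)).ne'
    have hgs : g ^ s ≠ 0 := by simp [hg0, hgt]
    have hΓ0 : Γ s ≠ 0 := ((pos_iff_ne_zero.2 hgs).trans_le (hg s hs hs2)).ne'
    have hsplit : Γ s ^ (1 / s - 1 / 2) =
        (Γ s ^ (1 / s)) ^ (1 / 2 : ℝ) * Γ s ^ (-((s - 1) / (2 * s))) := by
      rw [← ENNReal.rpow_mul, ← ENNReal.rpow_add _ _ hΓ0 (hΓ s hs hs2)]
      congr 1
      field_simp
      ring
    have hle : Γ s ^ (-((s - 1) / (2 * s))) ≤ c s := by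
      have h1 : c s = (g ^ s) ^ (-((s - 1) / (2 * s))) := by
        simp only [c]
        rw [← ENNReal.rpow_mul]
        congr 1
        field_simp
      rw [h1, ENNReal.rpow_neg, ENNReal.rpow_neg]
      refine ENNReal.inv_le_inv.2 (ENNReal.rpow_le_rpow (hg s hs hs2) ?_)
      have : 0 < s - 1 := by linarith
      positivity
    have hdd : d = d ^ (1 / 2 : ℝ) * d ^ (1 / 2 : ℝ) := by
      rw [← ENNReal.rpow_add _ _ hd0 ENNReal.ofReal_ne_top]
      norm_num
    calc d * N s ^ (1 / s) ≤ d * (e s * Γ s ^ (1 / s - 1 / 2)) := by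
          gcongr
          exact hN s hs hs2
      _ = (d ^ (1 / 2 : ℝ) * e s) * ((d ^ (1 / 2 : ℝ) * (Γ s ^ (1 / s)) ^ (1 / 2 : ℝ)) *
            Γ s ^ (-((s - 1) / (2 * s)))) := by
          rw [hsplit]
          conv_lhs => rw [hdd]
          ring
      _ ≤ W * (X s * c s) := by
          simp only [X]
          rw [ENNReal.mul_rpow_of_nonneg _ _ (by norm_num : (0 : ℝ) ≤ 1 / 2)]
          gcongr
          exact he s hs hs2
  refine (limsup_le_limsup hev).trans ?_
  rw [ENNReal.limsup_const_mul_of_ne_top hW]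
  refine mul_le_mul' le_rfl ?_
  have h3 := hc.limsup_eq
  refine (ENNReal.limsup_mul_le' (Or.inr ?_) (Or.inr ?_)).trans ?_
  · rw [h3]
    exact ENNReal.one_ne_top
  · rw [h3]
    exact one_ne_zero
  · rw [h3, mul_one]
    exact (limsup_rpow_half _ _).le

end Interpolation

/-- A bound of order `(s - 1)⁻¹` on the Schatten `s`-norms of a compact operator gives membership
in `𝓛^{1,∞}`. -/
theorem IsSingularBasis.memWeakTraceIdeal {H J : Type*} [NormedAddCommGroup H]
    [InnerProductSpace ℂ H] [CompleteSpace H] {T : H →L[ℂ] H} (hT : IsCompactOperator T)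
    {b : HilbertBasis J ℂ H} {t : J → ℝ} (hb : IsSingularBasis T b t) {M : ℝ} (hM : 0 ≤ M)
    (h : ∀ s : ℝ, 1 < s → s ≤ 2 →
      (∑' j, ENNReal.ofReal (t j) ^ s) ^ (1 / s) ≤ ENNReal.ofReal (M / (s - 1))) :
    MemWeakTraceIdeal T := by
  have hfin : ∀ s : ℝ, 1 < s → s ≤ 2 → ∀ S : Finset J, ∑ j ∈ S, t j ^ s ≤ (M / (s - 1)) ^ s := by
    intro s hs hs2 S
    have hs0 : 0 < s := by linarith
    have hs1 : 0 < s - 1 := by linarith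
    have h1 := ENNReal.rpow_le_rpow (h s hs hs2) hs0.le
    rw [← ENNReal.rpow_mul, one_div_mul_cancel hs0.ne', ENNReal.rpow_one,
      ENNReal.ofReal_rpow_of_nonneg (by positivity) hs0.le] at h1
    have h2 := (ENNReal.sum_le_tsum S).trans h1
    have h3 : ∑ j ∈ S, ENNReal.ofReal (t j) ^ s = ENNReal.ofReal (∑ j ∈ S, t j ^ s) := by
      rw [ENNReal.ofReal_sum_of_nonneg fun j _ => Real.rpow_nonneg (hb.nonneg j) s]
      exact Finset.sum_congr rfl fun j _ => ENNReal.ofReal_rpow_of_nonneg (hb.nonneg j) hs0.le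
    rw [h3] at h2
    exact (ENNReal.ofReal_le_ofReal_iff (by positivity)).1 h2
  refine ⟨hT, max ((Real.log 2)⁻¹ * singularValue T 0) (Real.exp 1 * M), fun k hk => ?_⟩
  -- For `k = 1` the choice of `s` below would exceed `2`, as `log 2 < 1`; from `k = 2` on, `1 + k ≥
  -- 3 > e`.
  rcases hk.eq_or_lt with rfl | hk2
  · refine le_max_of_le_left (le_of_eq ?_)
    norm_num
  · refine le_max_of_le_right ?_
    have hk3 : (3 : ℝ) ≤ 1 + k := by
      have : (2 : ℝ) ≤ k := by exact_mod_cast hk2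
      linarith
    set L := Real.log (1 + (k : ℝ)) with hL
    have hL1 : 1 ≤ L := by
      rw [hL, Real.le_log_iff_exp_le (by linarith)]
      linarith [Real.exp_one_lt_d9]
    have hL0 : 0 < L := by linarith
    -- With this `s`, the factor `1/(s-1)` is the logarithm itself, while `k^(1 - 1/s)` stays below
    -- `e`.
    set s := 1 + L⁻¹ with hs
    have hs1 : 1 < s := by
      have : 0 < L⁻¹ := by positivity
      linarith
    have hs2 : s ≤ 2 := by
      have : L⁻¹ ≤ 1 := inv_le_one_of_one_le₀ hL1
      linarith
    have hsub : s - 1 = L⁻¹ := by rw [hs]; ring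
    have h1 := hb.sum_singularValue_le hs1 (hfin s hs1 hs2) (by
      rw [hsub]
      positivity) k
    have h2 : (k : ℝ) ^ (1 - 1 / s) ≤ Real.exp 1 := by
      have hk0 : (1 : ℝ) ≤ k := by linarith
      have hexp : 1 - 1 / s ≤ L⁻¹ := by
        have hs0 : 0 < s := by linarith
        rw [← hsub, sub_le_sub_iff, ← sub_le_iff_le_add, ← sub_nonneg]
        have : s - (1 + 1 - 1 / s) = (s - 1) ^ 2 / s := by
          field_simp
          ring
        rw [this]
        positivity
      calc (k : ℝ) ^ (1 - 1 / s) ≤ (k : ℝ) ^ L⁻¹ := Real.rpow_le_rpow_of_exponent_le hk0 hexp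
        _ ≤ (1 + (k : ℝ)) ^ L⁻¹ := Real.rpow_le_rpow (by positivity) (by linarith) (by positivity)
        _ = Real.exp 1 := by
          rw [Real.rpow_def_of_pos (by positivity), ← hL, mul_inv_cancel₀ hL0.ne']
    rw [inv_mul_le_iff₀ hL0]
    refine h1.trans ?_
    rw [hsub, div_inv_eq_mul]
    calc (k : ℝ) ^ (1 - 1 / s) * (M * L) ≤ Real.exp 1 * (M * L) := by gcongr
      _ = L * (Real.exp 1 * M) := by ring

end CwikelType

/-! ### The Cwikel-type estimate -/

open CwikelType in
theorem corollary4p4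
    {H : Type*} [NormedAddCommGroup H] [InnerProductSpace ℂ H] [CompleteSpace H]
    [TopologicalSpace.SeparableSpace H]
    (D : H →ₗ.[ℂ] H) (hDsa : IsSelfAdjoint D) (hDres : HasCompactResolvent D)
    {ι : Type*} (h : HilbertBasis ι ℂ H) (ev : ι → ℝ)
    (hD : ∀ m, IsEigenvectorOf D (h m) (ev m : ℂ))
    (G : ℝ → ℂ) (hGmeas : Measurable G) (hGbdd : ∃ C : ℝ, ∀ x, ‖G x‖ ≤ C)
    (hG : MemWeakTraceIdeal (functionOf G hGbdd h ev))
    {F : Type*} [MeasurableSpace F] (μ : Measure F) (U : H ≃ₗᵢ[ℂ] Lp ℂ 2 μ)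
    (f : F → ℂ) (hf : AEStronglyMeasurable f μ) :
    (ClosureMemWeakTraceIdeal
        (compBounded (multiplicationOperator U f) (functionOf G hGbdd h ev)) →
      MemLp f 2 (spectralMeasure U h ev G 2)) ∧
    (MemWeakLp U h ev G 2 f →
      ∃ T : H →L[ℂ] H,
        HasBoundedClosure
          (compBounded (multiplicationOperator U f) (functionOf G hGbdd h ev)) T ∧
        MemWeakTraceIdeal T ∧
        zNorm T ≤ weakNorm U h ev G 2 f *
          zNorm (functionOf G hGbdd h ev) ^ (1 / 2 : ℝ)) := by
  have hcount : Countable ι := countable_index_of_hilbertBasis h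
  set g : ι → ℝ≥0∞ := fun m => ‖G (ev m)‖ₑ with hg
  set α : ι → ℝ≥0∞ := fun m => ∫⁻ t, ‖f t‖ₑ ^ 2 * ‖U (h m) t‖ₑ ^ 2 ∂μ with hα
  have heL : ∀ s : ℝ, 0 ≤ s →
      eLpNorm f 2 (spectralMeasure U h ev G s) ^ 2 = ∑' m, g m ^ s * α m := fun s hs =>
    eLpNorm_spectralMeasure_sq U h ev G hf hs
  have hsq : ∀ x : ℝ≥0∞, x ^ (2 : ℝ) = x ^ 2 := fun x => by
    rw [← ENNReal.rpow_natCast]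
    norm_num
  constructor
  · rintro ⟨T, hTcl, hT⟩
    have hrel := (hasBoundedClosure_iff U f _).1 hTcl
    refine ⟨hf.mono_ac (withDensity_absolutelyContinuous _ _), ?_⟩
    obtain ⟨J, b, t, hb⟩ := exists_isSingularBasis hT.1
    obtain ⟨K, -, hK⟩ := hT.exists_tsum_rpow_le hb
    have h1 := (hK 2 (by norm_num) le_rfl).trans_lt ENNReal.ofReal_lt_top
    have h2 : ∑' m, g m ^ (2 : ℝ) * α m = ∑' j, ENNReal.ofReal (t j) ^ (2 : ℝ) := by
      have h3 : ∀ j, ENNReal.ofReal (t j) = ‖T (b j)‖ₑ := fun j => by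
        rw [← hb.norm_apply j, ofReal_norm]
      simp only [hsq, h3]
      rw [tsum_enorm_apply_sq_eq T b h]
      exact tsum_congr fun m => (enorm_sq_of_ae_eq U h ev G hGbdd hf (hrel (h m))).symm
    rw [← h2, ← heL 2 (by norm_num)] at h1
    by_contra hcon
    rw [not_lt, top_le_iff] at hcon
    rw [hcon] at h1
    simp at h1
  · rintro ⟨hmem, hW⟩
    -- The case `s = 2` makes the prospective columns square summable.
    have hfin : ∑' m, g m ^ 2 * α m ≠ ∞ := by
      have h1 := heL 2 (by norm_num)
      simp only [hsq] at h1
      rw [← h1]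
      exact ENNReal.pow_ne_top (hmem 2 (by norm_num)).2.ne
    have hLp := fun m => memLp_mul_functionOf_basis U h ev G hGbdd hf
      (ENNReal.lt_top_of_tsum_ne_top hfin m)
    let v : ι → H := fun m => U.symm ((hLp m).toLp _)
    have hv : ∀ m, (fun t => f t * U (functionOf G hGbdd h ev (h m)) t) =ᵐ[μ] U (v m) :=
      fun m => by
        simp only [v, LinearIsometryEquiv.apply_symm_apply]
        exact (hLp m).coeFn_toLp.symm
    have hvn : ∀ m, ‖v m‖ₑ ^ 2 = g m ^ 2 * α m := fun m =>
      enorm_sq_of_ae_eq U h ev G hGbdd hf (hv m)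
    have hsum : Summable fun m => ‖v m‖ ^ 2 := by
      simp only [← hvn] at hfin
      refine (ENNReal.summable_toReal hfin).congr fun m => ?_
      simp
    obtain ⟨T, hTc, hTv⟩ := exists_isCompactOperator_of_summable h v hsum
    obtain ⟨J, b, t, hb⟩ := exists_isSingularBasis hTc
    have hGb : IsSingularBasis (functionOf G hGbdd h ev) h fun m => ‖G (ev m)‖ :=
      isSingularBasis_diagonalOperator h _ _
    obtain ⟨K, hK1, hK⟩ := hG.exists_tsum_rpow_le hGb
    simp only [ofReal_norm] at hK
    have hWe : ∀ s : ℝ, 1 < s → s ≤ 2 → ENNReal.ofReal (s - 1) ^ (1 / 2 : ℝ) *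
        eLpNorm f 2 (spectralMeasure U h ev G s) ≤ weakNorm U h ev G 2 f := fun s hs hs2 =>
      le_iSup₂_of_le s ⟨hs, hs2⟩ (by simp)
    have hN : ∀ s : ℝ, 1 < s → s ≤ 2 → (∑' j, ENNReal.ofReal (t j) ^ s) ^ (1 / s) ≤
        eLpNorm f 2 (spectralMeasure U h ev G s) * (∑' m, g m ^ s) ^ (1 / s - 1 / 2) :=
      fun s hs hs2 => by
        refine rpow_one_div_le_of_le hs ?_
        rw [heL s (by linarith)]
        refine (hb.tsum_rpow_le h (by linarith) hs2).trans ?_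
        simp only [hTv]
        exact tsum_rpow_le_of_sq_eq hvn hs hs2
    have hTz : zNorm T = limsup (fun s : ℝ => ENNReal.ofReal (s - 1) *
        (∑' j, ENNReal.ofReal (t j) ^ s) ^ (1 / s)) (𝓝[>] (1 : ℝ)) := by
      refine limsup_congr ?_
      filter_upwards [self_mem_nhdsWithin] with s hs
      rw [hb.positiveTrace_abs_rpow (zero_le_one.trans (le_of_lt hs))]
    have hGz : zNorm (functionOf G hGbdd h ev) = limsup (fun s : ℝ => ENNReal.ofReal (s - 1) *
        (∑' m, g m ^ s) ^ (1 / s)) (𝓝[>] (1 : ℝ)) := by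
      refine limsup_congr ?_
      filter_upwards [self_mem_nhdsWithin] with s hs
      rw [hGb.positiveTrace_abs_rpow (zero_le_one.trans (le_of_lt hs))]
      simp only [ofReal_norm, hg]
    refine ⟨T, hasBoundedClosure_of_basis U f _ h fun m => by rw [hTv]; exact hv m, ?_, ?_⟩
    · refine hb.memWeakTraceIdeal hTc
        (M := (weakNorm U h ev G 2 f).toReal * K) (by positivity) fun s hs hs2 => ?_
      exact rpow_one_div_le_of_bounds hs hs2 (hN s hs hs2) (hWe s hs hs2) hW.ne hK1 (hK s hs hs2)
    · rw [hTz, hGz]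
      -- The limit argument needs a nonzero `g m₀` as lower bound for `Γ`. If there is none, all
      -- columns of `T` vanish and so does its norm.
      by_cases hzero : ∀ m, g m = 0
      · have h0 : ∀ j, t j = 0 := fun j => by
          have hT0 : ∀ m, ‖T (h m)‖ₑ = 0 := fun m => by
            have := hvn m
            rw [hzero m] at this
            rw [hTv]
            simpa using this
          have h1 := tsum_enorm_apply_sq_eq T b h
          simp only [hT0] at h1
          have h2 : ‖T (b j)‖ₑ ^ 2 = 0 := by
            refine ENNReal.tsum_eq_zero.1 (h1.trans ?_) j
            simp
          rw [← hb.norm_apply j]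
          simpa using h2
        refine (limsup_le_limsup (v := fun _ => (0 : ℝ≥0∞)) ?_).trans (by simp)
        filter_upwards [self_mem_nhdsWithin] with s hs
        have hs0 : (0 : ℝ) < s := zero_lt_one.trans hs
        simp [h0, hs0]
      · push Not at hzero
        obtain ⟨m₀, hm₀⟩ := hzero
        exact limsup_schatten_le (g := g m₀) hN hWe hW.ne
          (fun s hs hs2 => ((hK s hs hs2).trans_lt ENNReal.ofReal_lt_top).ne)
          (fun s _ _ => ENNReal.le_tsum m₀) hm₀ enorm_ne_top
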